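/- Let $k$ be a field, $K/k$ a finitely generated field extension, and $\nu : K \to \Gamma\cup\{\infty\}$ a surjective valuation, trivial on $k$, with archimedean value group $\Gamma$, which is $k$-rational (its residue field is $k$). A \emph{parameterized regular local model} $\mathcal A=(\mathcal O;(\boldsymbol x,\boldsymbol y))$ for $K/k,\nu$ consists of the local ring $\mathcal O\subset K$ of the center of $\nu$ in some projective model of $K/k$, assumed regular, and a regular system of parameters $(\boldsymbol x,\boldsymbol y)=(x_1,\dots,x_r,y_1,\dots,y_s)$ of $\mathcal O$ such that $\nu(x_1),\dots,\nu(x_r)$ is a basis of $\Gamma\otimes_{\mathbb Z}\mathbb Q$. The $x_i$ are the independent variables and the $y_j$ the dependent variables. A blow-up $\mathcal A\to\mathcal A'$ with center $(x_i,x_j)$, $i\ne j$, or $(x_i,y_\ell)$ passes to a parameterized regular local model $\mathcal A'=(\mathcal O';(\boldsymbol x',\boldsymbol y'))$ with $\mathcal O'=\mathcal O[\boldsymbol x',\boldsymbol y']_{(\boldsymbol x',\boldsymbol y')}$, where $(\boldsymbol x',\boldsymbol y')$ is obtained from $(\boldsymbol x,\boldsymbol y)$ as follows. If the two variables $u,v$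 of the center satisfy $\nu(u)<\nu(v)$, then $v$ is replaced by $v/u$ (a \emph{combinatorial} blow-up). If the center is $(x_i,y_\ell)$ and $\nu(x_i)=\nu(y_\ell)$, then $y_\ell$ is replaced by $y_\ell/x_i-\lambda$, where $\lambda\in k$ satisfies $\nu(y_\ell/x_i-\lambda)>0$ (a \emph{blow-up with translation}). All other variables are unchanged. For a dependent variable $y_\ell$ of $\mathcal A$, the $\ell$-th \emph{contact rational function} is $\phi_\ell=y_\ell^d/\boldsymbol x^{\boldsymbol p}$, where $d\in\mathbb Z_{>0}$ and $\boldsymbol p\in\mathbb Z^r$ are the integers with $\nu(y_\ell^d/\boldsymbol x^{\boldsymbol p})=0$ and $\gcd(d,p_1,\dots,p_r)=1$; the integer $d$ is the $\ell$-th \emph{ramification index} of $\mathcal A$. An \emph{$\ell$-Puiseux's package} is a finite sequence of blow-ups of parameterized regular local models $$\mathcal A=\mathcal A_0\to\mathcal A_1\to\cdots\to\mathcal A_N\to\mathcal A'\qquad(N\ge 0)$$ such that each $\mathcal A_t\to\mathcal A_{t+1}$, $0\le t<N$, is a combinatorial blow-up with center of the form $(x_i,x_j)$ or $(x_i,y_\ell)$,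 in the variables of $\mathcal A_t$, and $\mathcal A_N\to\mathcal A'$ is a blow-up with translation with center of the form $(x_i,y_\ell)$; moreover, the center $(x_i,y_\ell)$ is not used for $\mathcal A_t\to\mathcal A_{t+1}$, $t<N$, when the $\ell$-th ramification index of $\mathcal A_t$ is $1$ and $\nu(y_\ell)<\nu(x_i)$ in $\mathcal A_t$. \textbf{Proposition.} For every parameterized regular local model $\mathcal A$ for $K/k,\nu$ and every dependent variable $y_\ell$ of $\mathcal A$ there is an $\ell$-Puiseux's package $\mathcal A\to\mathcal A'$. Moreover it can be chosen so that, with $\phi_\ell=y_\ell^d/\boldsymbol x^{\boldsymbol p}$ the $\ell$-th contact rational function of $\mathcal A$ and $\xi\in k\setminus\{0\}$ the constant with $\nu(\phi_\ell-\xi)>0$, the $\ell$-th dependent variable of $\mathcal A'$ is $$y'_\ell=\frac{y_\ell^d}{\boldsymbol x^{\boldsymbol p}}-\xi .$$ -/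

import Mathlib

open scoped TensorProduct

noncomputable section

namespace PuiseuxPackages

section Valuations

variable {K Γ : Type*} [Field K] [AddCommGroup Γ] [LinearOrder Γ] [IsOrderedAddMonoid Γ]

/-- The valuation ring `R_ν = {x ∈ K | ν x ≥ 0}`. -/
def valuationRing (ν : AddValuation K (WithTop Γ)) : ValuationSubring K :=
  (AddValuation.toValuation ν).valuationSubring

theorem mem_valuationRing_iff (ν : AddValuation K (WithTop Γ)) (x : K) :
    x ∈ valuationRing ν ↔ 0 ≤ ν x := Iff.rfl

/-- `ν` is a valuation of `K / k` with value group `Γ`: it maps `K` onto `Γ ∪ {∞}` and it vanishes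
on the nonzero elements of `k`. -/
structure IsValuationOf (k : Type*) [Field k] [Algebra k K]
    (ν : AddValuation K (WithTop Γ)) : Prop where
  surjective : Function.Surjective ν
  map_algebraMap : ∀ a : k, a ≠ 0 → ν (algebraMap k K a) = 0

theorem IsValuationOf.algebraMap_mem {k : Type*} [Field k] [Algebra k K]
    {ν : AddValuation K (WithTop Γ)} (h : IsValuationOf k ν) (a : k) :
    algebraMap k K a ∈ (valuationRing ν).toSubring := by
  change 0 ≤ ν (algebraMap k K a)
  by_cases ha : a = 0
  · subst ha
    simp
  · rw [h.map_algebraMap a ha]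

/-- The structure map `k → κ_ν = R_ν / 𝔪_ν`. -/
def IsValuationOf.toResidueField {k : Type*} [Field k] [Algebra k K]
    {ν : AddValuation K (WithTop Γ)} (h : IsValuationOf k ν) :
    k →+* IsLocalRing.ResidueField (valuationRing ν) :=
  (IsLocalRing.residue (valuationRing ν)).comp
    ((algebraMap k K).codRestrict (valuationRing ν).toSubring h.algebraMap_mem)

/-- `ν` is a `k`-rational valuation of `K / k`: the residue field of `ν` is `k`. -/
def IsRationalValuation (k : Type*) [Field k] [Algebra k K]
    (ν : AddValuation K (WithTop Γ)) : Prop :=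
  ∃ h : IsValuationOf k ν, Function.Bijective h.toResidueField

end Valuations

section ProjectiveModels

variable {k K : Type*} [Field k] [Field K] [Algebra k K]

variable (k K) in
/-- A projective model of `K / k`, given by the homogeneous coordinates `(f_0 : ⋯ : f_m)` in `K` of
its generic point. It is the projective variety in `ℙ^m` over `k` whose (nonempty) standard affine
pieces are the spectra of the rings `k[f_0 / f_i, …, f_m / f_i] ⊆ K`, for `f_i ≠ 0`; its function
field is `k(f_j / f_i)_{i, j} = K`. -/
structure ProjectiveModel where
  m : ℕ
  f : Fin (m + 1) → K
  exists_ne_zero : ∃ i, f i ≠ 0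
  adjoin_eq_top : IntermediateField.adjoin k {z : K | ∃ i j, f i ≠ 0 ∧ z = f j / f i} = ⊤

/-- The coordinate ring `k[f_0 / f_i, …, f_m / f_i]` of the `i`-th affine piece. -/
def ProjectiveModel.chart (M : ProjectiveModel k K) (i : Fin (M.m + 1)) : Subring K :=
  (Algebra.adjoin k (Set.range fun j => M.f j / M.f i)).toSubring

/-- `O` is the local ring `𝒪_{M, P} ⊆ K` of some point `P` of the projective model `M`. -/
def ProjectiveModel.IsLocalRingAtPoint (M : ProjectiveModel k K) (O : LocalSubring K) : Prop :=
  ∃ i, M.f i ≠ 0 ∧ ∃ (P : Ideal (M.chart i)) (_ : P.IsPrime), O = LocalSubring.ofPrime (M.chart i) P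

/-- `O` is the local ring of the center of `ν` in the projective model `M`: the local ring of a
point of `M` that is dominated by the valuation ring of `ν`. -/
def ProjectiveModel.IsLocalRingAtCenter {Γ : Type*} [AddCommGroup Γ] [LinearOrder Γ]
    [IsOrderedAddMonoid Γ] (M : ProjectiveModel k K) (ν : AddValuation K (WithTop Γ))
    (O : LocalSubring K) : Prop :=
  M.IsLocalRingAtPoint O ∧ O ≤ (valuationRing ν).toLocalSubring

end ProjectiveModels

section Models

variable (k : Type*) {K Γ : Type*} [Field k] [Field K] [Algebra k K]
  [AddCommGroup Γ] [LinearOrder Γ] [IsOrderedAddMonoid Γ]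

/-- A parameterized regular local model `(𝒪; (x, y))` for `K / k, ν`, with `r` independent
variables `x` and `s` dependent variables `y`. -/
structure RegularLocalModel (ν : AddValuation K (WithTop Γ)) (r s : ℕ) where
  O : LocalSubring K
  x : Fin r → K
  y : Fin s → K
  isCenter : ∃ M : ProjectiveModel k K, M.IsLocalRingAtCenter ν O
  regular : IsRegularLocalRing O.toSubring
  /-- `(x, y)` is a regular system of parameters of `𝒪`: its members lie in `𝒪`, generate the
  maximal ideal, and their number is the Krull dimension. -/
  params_mem : Set.range x ∪ Set.range y ⊆ O.toSubring
  span_params : Ideal.span {t : O.toSubring | (t : K) ∈ Set.range x ∪ Set.range y} =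
    IsLocalRing.maximalIdeal O.toSubring
  dim_eq : ringKrullDim O.toSubring = (r + s : ℕ)
  /-- The values of the independent variables form a basis of `Γ ⊗ ℚ`. -/
  values_basis : ∃ b : Module.Basis (Fin r) ℚ (ℚ ⊗[ℤ] Γ),
    ∀ i, ∃ γ : Γ, ν (x i) = (γ : WithTop Γ) ∧ b i = (1 : ℚ) ⊗ₜ[ℤ] γ

end Models

section Blowups

variable {k K Γ : Type*} [Field k] [Field K] [Algebra k K]
  [AddCommGroup Γ] [LinearOrder Γ] [IsOrderedAddMonoid Γ]
  {ν : AddValuation K (WithTop Γ)} {r s : ℕ}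

/-- `O'` is the localization of the ring `O[T]` at its ideal generated by `T`. -/
def IsLocalizedAdjoin (O : LocalSubring K) (T : Set K) (O' : LocalSubring K) : Prop :=
  ∃ (P : Ideal (Subring.closure ((O.toSubring : Set K) ∪ T))) (_ : P.IsPrime),
    P = Ideal.span {t : Subring.closure ((O.toSubring : Set K) ∪ T) | (t : K) ∈ T} ∧
    O' = LocalSubring.ofPrime (Subring.closure ((O.toSubring : Set K) ∪ T)) P

/-- `𝒪' = 𝒪[x', y']_{(x', y')}`. -/
def IsBlowupRing (A A' : RegularLocalModel k ν r s) : Prop :=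
  IsLocalizedAdjoin A.O (Set.range A'.x ∪ Set.range A'.y) A'.O

/-- `A → A'` is the (combinatorial) blow-up of `A` with center `(x_i, x_j)`. -/
def IsBlowupIndep (i j : Fin r) (A A' : RegularLocalModel k ν r s) : Prop :=
  IsBlowupRing A A' ∧ A'.y = A.y ∧
    ((ν (A.x i) < ν (A.x j) ∧ A'.x = Function.update A.x j (A.x j / A.x i)) ∨
     (ν (A.x j) < ν (A.x i) ∧ A'.x = Function.update A.x i (A.x i / A.x j)))

/-- `A → A'` is the blow-up of `A` with center `(x_i, y_l)`, and it is combinatorial. -/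
def IsCombinatorialBlowupDep (i : Fin r) (l : Fin s) (A A' : RegularLocalModel k ν r s) : Prop :=
  IsBlowupRing A A' ∧
    ((ν (A.x i) < ν (A.y l) ∧ A'.x = A.x ∧ A'.y = Function.update A.y l (A.y l / A.x i)) ∨
     (ν (A.y l) < ν (A.x i) ∧ A'.x = Function.update A.x i (A.x i / A.y l) ∧ A'.y = A.y))

/-- `A → A'` is the blow-up of `A` with center `(x_i, y_l)`, and it is a blow-up with
translation. -/
def IsTranslationBlowup (i : Fin r) (l : Fin s) (A A' : RegularLocalModel k ν r s) : Prop :=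
  IsBlowupRing A A' ∧ ν (A.x i) = ν (A.y l) ∧ A'.x = A.x ∧
    ∃ c : k, 0 < ν (A.y l / A.x i - algebraMap k K c) ∧
      A'.y = Function.update A.y l (A.y l / A.x i - algebraMap k K c)

/-- The rational function `y_l ^ d / x ^ p`. -/
def contactFunction (A : RegularLocalModel k ν r s) (l : Fin s) (d : ℕ) (p : Fin r → ℤ) : K :=
  A.y l ^ d / ∏ i, A.x i ^ p i

/-- `y_l ^ d / x ^ p` is the `l`-th contact rational function of `A` (and so `d` is the `l`-th
ramification index): `d ν(y_l) = p_1 ν(x_1) + ⋯ + p_r ν(x_r)`, `d > 0` and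
`gcd (d, p_1, …, p_r) = 1`. -/
def IsContactExponent (A : RegularLocalModel k ν r s) (l : Fin s) (d : ℕ) (p : Fin r → ℤ) : Prop :=
  0 < d ∧ Nat.gcd d (Finset.univ.gcd fun i => (p i).natAbs) = 1 ∧
    ν (contactFunction A l d p) = 0

/-- `IsPuiseuxPackage l A A'`: there is an `l`-Puiseux's package `A → A_1 → ⋯ → A_N → A'`, a finite
sequence of blow-ups of parameterized regular local models in which all but the last are
combinatorial with centers `(x_i, x_j)` or `(x_i, y_l)`, and the last is a blow-up with translation
with center `(x_i, y_l)`. If the `l`-th ramification index of `A_t` is `1` and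
`ν(y_l) < ν(x_i)` in `A_t`, then the center `(x_i, y_l)` is not allowed. -/
inductive IsPuiseuxPackage (l : Fin s) :
    RegularLocalModel k ν r s → RegularLocalModel k ν r s → Prop
  | translation {A A' : RegularLocalModel k ν r s} (i : Fin r) (h : IsTranslationBlowup i l A A') :
      IsPuiseuxPackage l A A'
  | indep {A B A' : RegularLocalModel k ν r s} (i j : Fin r) (hij : i < j)
      (h : IsBlowupIndep i j A B) (hB : IsPuiseuxPackage l B A') : IsPuiseuxPackage l A A'
  | dep {A B A' : RegularLocalModel k ν r s} (i : Fin r) (h : IsCombinatorialBlowupDep i l A B)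
      (hA : ¬ ((∃ p, IsContactExponent A l 1 p) ∧ ν (A.y l) < ν (A.x i)))
      (hB : IsPuiseuxPackage l B A') : IsPuiseuxPackage l A A'

end Blowups

end PuiseuxPackages

end

open PuiseuxPackages

/-! View the contact rational function as a Laurent monomial of value zero in `y_l` and the `x_i`,
with a primitive exponent vector `c` in which `y_l` has positive exponent `c none`. A combinatorial
blow-up that replaces `v` by `v / u` changes `c u` to `c u + c v` and keeps the monomial fixed as an
element of `K`. The valuation decides which of two variables plays the role of `u`, so one needs a
pair of exponents of opposite signs for which both possible moves decrease a well-founded measure;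
`exists_complexity_update_lt` supplies it. By descent the chosen pair eventually has equal values.
Two independent variables cannot, so the pair is `(x_i, y_l)`; primitivity then forces the monomial
to be `y_l / x_i`, and the translation produces the original contact function minus `ξ`.

The delicate move replaces `x_i` by `x_i / y_l`. The game guarantees `c (some i) + c none > 0`
there. This keeps the exponent of `y_l` positive, keeps the values of the independent variables a
basis, and, as `c (some i) < 0`, gives `c none ≥ 2`, so the ramification index is not `1` and the
center is permitted.

It remains to see that blow-ups stay among regular local models (`IsRegularSystem.exists_blowup`).
Rationality of `ν` makes the center in the blow-up ring the ideal generated by the new parameters.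
For the dimension, the new local ring is a localization of `𝒪[X]` modulo `t_i (X + c) - t_j`
(`ringKrullDim_eq_card_of_blowup`); that there are no further relations follows because this
quotient is regular, hence a domain (`IsLocalRing.isDomain_of_card_le_ringKrullDim`). -/

/-! ### Regular local rings are domains; dimension of a blow-up ring -/

/-- A Noetherian local ring of dimension at least `n`, whose maximal ideal is generated by at most
`n` elements, is a domain. -/
theorem IsLocalRing.isDomain_of_card_le_ringKrullDim (n : ℕ) :
    ∀ (R : Type*) [CommRing R] [IsLocalRing R] [IsNoetherianRing R] (s : Finset R),
      Ideal.span (s : Set R) = IsLocalRing.maximalIdeal R → s.card ≤ n →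
      (n : WithBot ℕ∞) ≤ ringKrullDim R → IsDomain R := by
  classical
  induction n with
  | zero =>
    intro R _ _ _ s hs hcard _
    obtain rfl : s = ∅ := by simpa using hcard
    have : IsField R := by
      rw [IsLocalRing.isField_iff_maximalIdeal_eq, ← hs]; simp
    exact this.isDomain
  | succ n ih =>
    intro R _ _ _ s hs hcard hdim
    rcases s.eq_empty_or_nonempty with rfl | ⟨t, ht⟩
    · have : IsField R := by
        rw [IsLocalRing.isField_iff_maximalIdeal_eq, ← hs]; simp
      exact this.isDomain
    have htm : t ∈ IsLocalRing.maximalIdeal R := hs ▸ Ideal.subset_span ht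
    have hne : Ideal.span {t} ≠ ⊤ := by
      rw [Ideal.ne_top_iff_exists_maximal]
      exact ⟨_, IsLocalRing.maximalIdeal.isMaximal R, by simpa [Ideal.span_le] using htm⟩
    have : Nontrivial (R ⧸ Ideal.span {t}) := Ideal.Quotient.nontrivial_iff.2 hne
    have : IsLocalRing (R ⧸ Ideal.span {t}) :=
      .of_surjective' _ Ideal.Quotient.mk_surjective
    have hmax : IsLocalRing.maximalIdeal (R ⧸ Ideal.span {t}) =
        (IsLocalRing.maximalIdeal R).map (Ideal.Quotient.mk _) :=
      (IsLocalRing.map_maximalIdeal_of_surjective _ Ideal.Quotient.mk_surjective).symm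
    set s' := (s.erase t).image (Ideal.Quotient.mk (Ideal.span {t})) with hs'
    have hcard' : s'.card ≤ n := by
      refine Finset.card_image_le.trans ?_
      rw [Finset.card_erase_of_mem ht]; omega
    have hspan' : Ideal.span (s' : Set (R ⧸ Ideal.span {t})) =
        IsLocalRing.maximalIdeal (R ⧸ Ideal.span {t}) := by
      rw [hmax, ← hs, Ideal.map_span]
      apply le_antisymm
      · apply Ideal.span_mono
        rw [hs', Finset.coe_image]
        exact Set.image_mono (by simp)
      · rw [Ideal.span_le]
        rintro _ ⟨a, ha, rfl⟩
        by_cases hat : a = t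
        · subst hat
          have : Ideal.Quotient.mk (Ideal.span {a}) a = 0 :=
            Ideal.Quotient.eq_zero_iff_mem.2 (Ideal.mem_span_singleton_self a)
          rw [this]; exact zero_mem _
        · apply Ideal.subset_span
          rw [hs', Finset.coe_image]
          exact ⟨a, by simpa using ⟨ha, hat⟩, rfl⟩
    have hle : ringKrullDim (R ⧸ Ideal.span {t}) ≤ n := by
      refine (ringKrullDim_le_spanFinrank_maximalIdeal _).trans ?_
      rw [← hspan']
      have := Submodule.spanFinrank_span_le_ncard_of_finite
        (R := R ⧸ Ideal.span {t}) (s := (s' : Set (R ⧸ Ideal.span {t}))) s'.finite_toSet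
      rw [Set.ncard_coe_finset] at this
      exact_mod_cast this.trans hcard'
    have hge : (n : WithBot ℕ∞) ≤ ringKrullDim (R ⧸ Ideal.span {t}) := by
      have h := ringKrullDim_le_ringKrullDim_quotient_add_card ({t} : Finset R)
        (by simpa [IsLocalRing.ringJacobson_eq_maximalIdeal] using htm)
      rw [Finset.card_singleton, Finset.coe_singleton] at h
      have h2 := hdim.trans h
      push_cast at h2
      exact ENat.WithBot.add_le_add_one_right_iff.1 h2
    have hdom : IsDomain (R ⧸ Ideal.span {t}) := ih _ s' hspan' hcard' hge
    have hprime : (Ideal.span {t}).IsPrime := (Ideal.Quotient.isDomain_iff_prime _).1 hdom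
    -- a prime `q` at the bottom of a chain of length `n + 1`
    obtain ⟨c, hc⟩ := Order.le_krullDim_iff.1 hdim
    set q := c.head.asIdeal with hq
    have hqdim : ((n + 1 : ℕ) : WithBot ℕ∞) ≤ ringKrullDim (R ⧸ q) := by
      rw [ringKrullDim_quotient, ← hc]
      exact Order.LTSeries.length_le_krullDim
        (α := PrimeSpectrum.zeroLocus (q : Set R))
        ⟨c.length, fun i => ⟨c i, c.head_le i⟩, c.step⟩
    -- Otherwise some `x ∈ q` is nonzero in the domain `R / (t)`, so `R / (t, x)` has dimension less
    -- than `n`. But it surjects onto `R / (q, t)`, whose dimension is at least `n` because `R / q`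
    -- has dimension at least `n + 1`.
    have hqt : q ≤ Ideal.span {t} := by
      intro x hx
      by_contra hxt
      have hx0 : Ideal.Quotient.mk (Ideal.span {t}) x ≠ 0 := by
        rwa [Ne, Ideal.Quotient.eq_zero_iff_mem]
      have h1 := (ringKrullDim_quotient_succ_le_of_nonZeroDivisor
        (mem_nonZeroDivisors_of_ne_zero hx0)).trans hle
      have hqne : q ≠ ⊤ := c.head.isPrime.ne_top
      have : Nontrivial (R ⧸ q) := Ideal.Quotient.nontrivial_iff.2 hqne
      have : IsLocalRing (R ⧸ q) := .of_surjective' _ Ideal.Quotient.mk_surjective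
      have htm' : Ideal.Quotient.mk q t ∈ IsLocalRing.maximalIdeal (R ⧸ q) := by
        rw [← IsLocalRing.map_maximalIdeal_of_surjective _ Ideal.Quotient.mk_surjective]
        exact Ideal.mem_map_of_mem _ htm
      have h2 := ringKrullDim_le_ringKrullDim_quotient_add_card ({Ideal.Quotient.mk q t} : Finset _)
        (by simpa [IsLocalRing.ringJacobson_eq_maximalIdeal] using htm')
      rw [Finset.card_singleton, Finset.coe_singleton] at h2
      have h3 : ringKrullDim ((R ⧸ q) ⧸ Ideal.span {Ideal.Quotient.mk q t}) ≤
          ringKrullDim ((R ⧸ Ideal.span {t}) ⧸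
            Ideal.span {Ideal.Quotient.mk (Ideal.span {t}) x}) := by
        refine ringKrullDim_le_of_surjective (Ideal.Quotient.lift _ (Ideal.Quotient.lift _
          ((Ideal.Quotient.mk (Ideal.span {Ideal.Quotient.mk q t})).comp (Ideal.Quotient.mk q))
          ?_) ?_) ?_
        · intro a ha
          obtain ⟨b, rfl⟩ := Ideal.mem_span_singleton'.1 ha
          rw [RingHom.comp_apply, map_mul, Ideal.Quotient.eq_zero_iff_mem]
          exact Ideal.mul_mem_left _ _ (Ideal.mem_span_singleton_self _)
        · intro a ha
          obtain ⟨b, rfl⟩ := Ideal.mem_span_singleton'.1 ha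
          obtain ⟨b, rfl⟩ := Ideal.Quotient.mk_surjective b
          rw [← map_mul, Ideal.Quotient.lift_mk, RingHom.comp_apply,
            Ideal.Quotient.eq_zero_iff_mem.2 (Ideal.mul_mem_left q b hx), map_zero]
        · refine Ideal.Quotient.lift_surjective_of_surjective _ _
            (Ideal.Quotient.lift_surjective_of_surjective _ _ ?_)
          exact Ideal.Quotient.mk_surjective.comp Ideal.Quotient.mk_surjective
      have h4 : ((n + 1 : ℕ) : WithBot ℕ∞) ≤ n :=
        hqdim.trans (h2.trans (le_trans (by push_cast; gcongr) h1))
      norm_cast at h4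
      omega
    have htq : t ∉ q := by
      intro h
      have : q = Ideal.span {t} := le_antisymm hqt (by simpa [Ideal.span_le] using h)
      rw [this] at hqdim
      have := hqdim.trans hle
      norm_cast at this
      omega
    -- Each element of `q` is a multiple `y * t` with `t ∉ q`, so `y ∈ q`; thus `q = 𝔪 q` and
    -- Nakayama applies.
    have hbot : q = ⊥ := by
      refine Submodule.eq_bot_of_le_smul_of_le_jacobson_bot (IsLocalRing.maximalIdeal R) q
        (IsNoetherian.noetherian q) ?_ (IsLocalRing.maximalIdeal_le_jacobson _)
      intro x hx
      obtain ⟨y, rfl⟩ := Ideal.mem_span_singleton'.1 (hqt hx)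
      have hy : y ∈ q := (c.head.isPrime.mem_or_mem hx).resolve_right htq
      rw [mul_comm]
      exact Submodule.smul_mem_smul htm hy
    have : (⊥ : Ideal R).IsPrime := hbot ▸ c.head.isPrime
    exact IsDomain.of_bot_isPrime R

open Polynomial in
-- Modulo `w` one has `u X = c`, so a sufficient power of `u` eliminates `X`.
theorem Polynomial.exists_pow_mul_sub_C_mem_span {R : Type*} [CommRing R] (u c : R) (w : R[X])
    (f : R[X]) (hw : w = C u * X - C c) :
    ∃ (m : ℕ) (a : R), C u ^ m * f - C a ∈ Ideal.span {w} := by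
  induction f using Polynomial.induction_on' with
  | add f g hf hg =>
    obtain ⟨m, a, h⟩ := hf
    obtain ⟨m', a', h'⟩ := hg
    refine ⟨m + m', u ^ m' * a + u ^ m * a', ?_⟩
    have := add_mem (Ideal.mul_mem_left _ (C u ^ m') h) (Ideal.mul_mem_left _ (C u ^ m) h')
    convert! this using 1
    simp only [map_add, map_mul, map_pow]
    ring
  | monomial n a =>
    refine ⟨n, a * c ^ n, ?_⟩
    rw [Ideal.mem_span_singleton]
    have := sub_dvd_pow_sub_pow (C u * X) (C c) n
    rw [hw]
    have h2 := this.mul_left (C a)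
    convert! h2 using 1
    rw [← C_mul_X_pow_eq_monomial]
    simp only [map_mul, map_pow]
    ring

theorem IsLocalRing.ringKrullDim_le_card_of_span_eq_maximalIdeal {R : Type*} [CommRing R]
    [IsLocalRing R] [IsNoetherianRing R] (s : Finset R)
    (hs : Ideal.span (s : Set R) = IsLocalRing.maximalIdeal R) : ringKrullDim R ≤ s.card := by
  refine (ringKrullDim_le_spanFinrank_maximalIdeal _).trans ?_
  rw [← hs]
  have := Submodule.spanFinrank_span_le_ncard_of_finite (R := R) (s := (s : Set R)) s.finite_toSet
  rw [Set.ncard_coe_finset] at this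
  exact_mod_cast this

open Polynomial in
-- With `n` parameters, `R[X]` localized at `(𝔪, X)` has dimension `n + 1`, and dividing by `w = t_i
-- (X + c) - t_j` leaves dimension at least `n` with `n` generators of the maximal ideal. The
-- quotient is therefore a domain of dimension `n`, and it is identified with `O'`.
theorem ringKrullDim_eq_card_of_blowup {R S O' : Type*} [CommRing R] [IsLocalRing R]
    [IsNoetherianRing R] [CommRing S] [IsDomain S] [CommRing O'] [Algebra S O'] (φ : R[X] →+* S)
    (hφ : Function.Surjective φ) (hinj : Function.Injective (φ.comp C)) {ι : Type*} [Fintype ι]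
    (t : ι → R) (ht : Ideal.span (Set.range t) = IsLocalRing.maximalIdeal R)
    (hdim : ringKrullDim R = Fintype.card ι) {i j : ι} (hij : i ≠ j) (c : R)
    (hz : φ (C (t i) * (X + C c)) = φ (C (t j))) (hti : t i ≠ 0) (P : Ideal S) [P.IsPrime]
    (hP : P.comap φ = (IsLocalRing.maximalIdeal R).map C ⊔ Ideal.span {X})
    [IsLocalization.AtPrime O' P] :
    IsNoetherianRing O' ∧ ringKrullDim O' = Fintype.card ι := by
  classical
  set m := IsLocalRing.maximalIdeal R with hm
  set Q : Ideal R[X] := P.comap φ with hQ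
  have hXQ : X ∈ Q := hP ▸ Ideal.mem_sup_right (Ideal.mem_span_singleton_self _)
  have hmQ : m ≤ Q.comap C := by
    rw [← Ideal.map_le_iff_le_comap, hP]; exact le_sup_left
  have hQm : Q.comap C = m :=
    ((IsLocalRing.maximalIdeal.isMaximal R).eq_of_le
      (Ideal.IsPrime.ne_top inferInstance) hmQ).symm
  have hQl : Q.LiesOver m := ⟨hQm.symm⟩
  have hQmax : Q.IsMaximal := by
    rw [Ideal.isMaximal_iff]
    refine ⟨(Ideal.ne_top_iff_one Q).1 (Ideal.IsPrime.ne_top inferInstance), fun J f hJ hf hfJ => ?_⟩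
    have hf0 : IsUnit (f.coeff 0) := by
      by_contra h
      apply hf
      rw [← f.divX_mul_X_add]
      exact add_mem (Ideal.mul_mem_left _ _ hXQ) (hmQ h)
    have : C (f.coeff 0) ∈ J := by
      have h2 : f - f.divX * X ∈ J := sub_mem hfJ (Ideal.mul_mem_left _ _ (hJ hXQ))
      rwa [sub_eq_of_eq_add' f.divX_mul_X_add.symm] at h2
    exact (Ideal.eq_top_iff_one _).1 (Ideal.eq_top_of_isUnit_mem _ this (hf0.map C))
  have hQdim : ringKrullDim (Localization.AtPrime Q) = (Fintype.card ι + 1 : ℕ) := by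
    rw [IsLocalization.AtPrime.ringKrullDim_eq_height Q, height_eq_height_add_one m Q]
    push_cast
    rw [IsLocalRing.maximalIdeal_height_eq_ringKrullDim, hdim]
  set B := Localization.AtPrime Q with hB
  set w : R[X] := C (t i) * (X + C c) - C (t j) with hw
  have htm : ∀ k, t k ∈ m := fun k => ht ▸ Ideal.subset_span ⟨k, rfl⟩
  have hwφ : φ w = 0 := by rw [hw, map_sub, hz, sub_self]
  have hwQ : w ∈ Q := by
    change φ w ∈ P
    rw [hwφ]; exact zero_mem _
  set g : B := algebraMap R[X] B w with hg
  have hBmax : IsLocalRing.maximalIdeal B = Q.map (algebraMap R[X] B) :=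
    Localization.AtPrime.map_eq_maximalIdeal.symm
  have hgm : g ∈ IsLocalRing.maximalIdeal B := hBmax ▸ Ideal.mem_map_of_mem _ hwQ
  have hne : Ideal.span {g} ≠ ⊤ := fun h => by
    have : (⊤ : Ideal B) ≤ IsLocalRing.maximalIdeal B := by
      rw [← h, Ideal.span_le]; simpa using hgm
    exact (IsLocalRing.maximalIdeal.isMaximal B).ne_top (top_le_iff.1 this)
  have : Nontrivial (B ⧸ Ideal.span {g}) := Ideal.Quotient.nontrivial_iff.2 hne
  have : IsLocalRing (B ⧸ Ideal.span {g}) := .of_surjective' _ Ideal.Quotient.mk_surjective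
  set π : R[X] →+* B ⧸ Ideal.span {g} := (Ideal.Quotient.mk _).comp (algebraMap R[X] B) with hπ
  have hπw : π w = 0 := Ideal.Quotient.eq_zero_iff_mem.2 (Ideal.mem_span_singleton_self g)
  have hmax : IsLocalRing.maximalIdeal (B ⧸ Ideal.span {g}) = Q.map π := by
    rw [← IsLocalRing.map_maximalIdeal_of_surjective _ Ideal.Quotient.mk_surjective, hBmax,
      Ideal.map_map]
  -- Modulo `w` the parameter `t j` is a multiple of `t i`, so `X` can take its slot.
  set s : Finset (B ⧸ Ideal.span {g}) :=
    Finset.univ.image fun k => if k = j then π X else π (C (t k)) with hs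
  have hscard : s.card ≤ Fintype.card ι := Finset.card_image_le
  have hsub : ∀ k, (if k = j then π X else π (C (t k))) ∈ Ideal.span (s : Set _) := fun k =>
    Ideal.subset_span (by rw [hs]; exact_mod_cast Finset.mem_image_of_mem _ (Finset.mem_univ k))
  have hspan : Ideal.span (s : Set _) = IsLocalRing.maximalIdeal (B ⧸ Ideal.span {g}) := by
    rw [hmax]
    apply le_antisymm
    · rw [Ideal.span_le, hs, Finset.coe_image]
      rintro _ ⟨k, -, rfl⟩
      dsimp only
      split_ifs
      · exact Ideal.mem_map_of_mem _ hXQ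
      · exact Ideal.mem_map_of_mem _ (hmQ (htm k))
    · have hPπ : Q.map π = (m.map C ⊔ Ideal.span {X}).map π := congrArg (Ideal.map π) hP
      rw [hPπ, Ideal.map_sup, Ideal.map_map, ← ht, Ideal.map_span, Ideal.map_span, sup_le_iff,
        Ideal.span_le, Ideal.span_le, Set.image_singleton, Set.singleton_subset_iff]
      constructor
      · rintro _ ⟨_, ⟨k, rfl⟩, rfl⟩
        by_cases hk : k = j
        · subst hk
          have h1 : π (C (t k)) = π (C (t i)) * π (X + C c) := by
            rw [← map_mul, eq_comm, ← sub_eq_zero, ← map_sub, ← hw, hπw]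
          have h2 := hsub i
          rw [if_neg hij] at h2
          change π (C (t k)) ∈ _
          rw [h1]
          exact Ideal.mul_mem_right _ _ h2
        · simpa [hk] using hsub k
      · simpa using hsub j
  have hge : (Fintype.card ι : WithBot ℕ∞) ≤ ringKrullDim (B ⧸ Ideal.span {g}) := by
    have h := ringKrullDim_le_ringKrullDim_quotient_add_card ({g} : Finset B)
      (by simpa [IsLocalRing.ringJacobson_eq_maximalIdeal] using hgm)
    rw [hQdim, Finset.card_singleton, Finset.coe_singleton] at h
    push_cast at h
    exact ENat.WithBot.add_le_add_one_right_iff.1 h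
  have hdom : IsDomain (B ⧸ Ideal.span {g}) :=
    IsLocalRing.isDomain_of_card_le_ringKrullDim _ _ s hspan hscard hge
  have hdim' : ringKrullDim (B ⧸ Ideal.span {g}) = Fintype.card ι :=
    le_antisymm ((IsLocalRing.ringKrullDim_le_card_of_span_eq_maximalIdeal s hspan).trans
      (by exact_mod_cast hscard)) hge
  -- the map `B → O'`
  have hle : Q.primeCompl ≤ P.primeCompl.comap φ := fun a ha => ha
  set ψ : B →+* O' := IsLocalization.map O' φ hle with hψ
  have hψa : ∀ a, ψ (algebraMap R[X] B a) = algebraMap S O' (φ a) :=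
    fun a => IsLocalization.map_eq hle a
  have hSO : Function.Injective (algebraMap S O') :=
    IsLocalization.injective O' (Ideal.primeCompl_le_nonZeroDivisors P)
  have hsurj : Function.Surjective ψ := by
    intro y
    obtain ⟨a, b, rfl⟩ := IsLocalization.exists_mk'_eq P.primeCompl y
    obtain ⟨a, rfl⟩ := hφ a
    obtain ⟨b, hb⟩ := b
    obtain ⟨b, rfl⟩ := hφ b
    exact ⟨IsLocalization.mk' B a (⟨b, hb⟩ : Q.primeCompl), IsLocalization.map_mk' hle _ _⟩
  have hti' : π (C (t i)) ≠ 0 := by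
    intro h
    have h1 : algebraMap R[X] B (C (t i)) ∈ Ideal.span {g} := Ideal.Quotient.eq_zero_iff_mem.1 h
    obtain ⟨b, hb⟩ := Ideal.mem_span_singleton'.1 h1
    have h2 := congrArg ψ hb
    rw [map_mul, hg, hψa, hψa, hwφ, map_zero, mul_zero] at h2
    have h3 : φ (C (t i)) = 0 := hSO (by rw [← h2, map_zero])
    exact hti (hinj (by simpa using h3))
  -- If `f` dies in `S`, then `t_i ^ n * f` is congruent modulo `w` to a constant `a`, which also
  -- dies and so vanishes by `hinj`. Since `B / (g)` is a domain in which `t i` is nonzero, `f` is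
  -- zero there.
  have hker : RingHom.ker ψ = Ideal.span {g} := by
    apply le_antisymm
    · intro b hb
      obtain ⟨f, q, rfl⟩ := IsLocalization.exists_mk'_eq Q.primeCompl b
      rw [RingHom.mem_ker, hψ, IsLocalization.map_mk', IsLocalization.mk'_eq_zero_iff] at hb
      obtain ⟨⟨e, he⟩, he'⟩ := hb
      have hf : φ f = 0 := (mul_eq_zero.1 he').resolve_left (fun h => he (by
        change e = 0 at h
        rw [h]; exact zero_mem _))
      obtain ⟨n, a, hna⟩ := exists_pow_mul_sub_C_mem_span (t i) (t j - t i * c) w f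
        (by rw [hw]; simp only [map_sub, map_mul]; ring)
      obtain ⟨e, he⟩ := Ideal.mem_span_singleton'.1 hna
      have ha : a = 0 := by
        have := congrArg φ he
        rw [map_mul, hwφ, mul_zero, map_sub, map_mul, hf, mul_zero, zero_sub, eq_comm,
          neg_eq_zero] at this
        exact hinj (by simpa using this)
      have h1 := congrArg π he
      rw [ha, map_zero, sub_zero, map_mul, hπw, mul_zero, map_mul, map_pow, eq_comm] at h1
      have h2 : π f = 0 := (mul_eq_zero.1 h1).resolve_left (pow_ne_zero _ hti')
      rw [IsLocalization.mk'_eq_mul_mk'_one]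
      exact Ideal.mul_mem_right _ _ (Ideal.Quotient.eq_zero_iff_mem.1 h2)
    · rw [Ideal.span_le, Set.singleton_subset_iff, SetLike.mem_coe, RingHom.mem_ker, hg, hψa, hwφ,
        map_zero]
  refine ⟨isNoetherianRing_of_surjective _ _ ψ hsurj, ?_⟩
  have he := ringKrullDim_eq_of_ringEquiv (R := B ⧸ RingHom.ker ψ) (S := O')
    (RingHom.quotientKerEquivOfSurjective hsurj)
  rw [← he, hker, hdim']

namespace PuiseuxPackages

/-! ### Centers of the valuation and their local rings -/

section Centers

variable {K Γ : Type*} [Field K] [AddCommGroup Γ] [LinearOrder Γ] [IsOrderedAddMonoid Γ]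

theorem mem_maximalIdeal_valuationRing_iff (ν : AddValuation K (WithTop Γ)) (a : valuationRing ν) :
    a ∈ IsLocalRing.maximalIdeal (valuationRing ν) ↔ 0 < ν a := by
  have ha : 0 ≤ ν a := a.2
  rw [IsLocalRing.mem_maximalIdeal, mem_nonunits_iff]
  constructor
  · intro h
    refine lt_of_le_of_ne ha fun h0 => h ?_
    have ha0 : (a : K) ≠ 0 := by
      intro h1
      rw [h1, AddValuation.map_zero] at h0
      exact WithTop.zero_ne_top h0
    have hi : (a : K)⁻¹ ∈ valuationRing ν := by
      rw [mem_valuationRing_iff, AddValuation.map_inv, ← h0]; simp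
    exact IsUnit.of_mul_eq_one ⟨_, hi⟩ (Subtype.ext (mul_inv_cancel₀ ha0))
  · intro h hu
    obtain ⟨b, hb⟩ := hu.exists_right_inv
    have hb0 : 0 ≤ ν b := b.2
    have h1 := congrArg (fun c : valuationRing ν => ν c) hb
    simp only [MulMemClass.coe_mul, AddValuation.map_mul, OneMemClass.coe_one,
      AddValuation.map_one] at h1
    exact (add_pos_of_pos_of_nonneg h hb0).ne' h1

/-- The center of `ν` in a subring of its valuation ring. -/
noncomputable def center (ν : AddValuation K (WithTop Γ)) (S : Subring K)
    (h : S ≤ (valuationRing ν).toSubring) : Ideal S :=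
  (IsLocalRing.maximalIdeal (valuationRing ν)).comap (Subring.inclusion h)

instance (ν : AddValuation K (WithTop Γ)) (S : Subring K) (h : S ≤ (valuationRing ν).toSubring) :
    (center ν S h).IsPrime :=
  Ideal.IsPrime.comap (K := IsLocalRing.maximalIdeal (valuationRing ν)) (Subring.inclusion h)

theorem mem_center_iff {ν : AddValuation K (WithTop Γ)} {S : Subring K}
    {h : S ≤ (valuationRing ν).toSubring} {a : S} : a ∈ center ν S h ↔ 0 < ν a :=
  mem_maximalIdeal_valuationRing_iff ν (Subring.inclusion h a)

theorem mem_ofPrime_iff {A : Subring K} {P : Ideal A} [P.IsPrime] {x : K} :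
    x ∈ (LocalSubring.ofPrime A P).toSubring ↔ ∃ a b : A, b ∉ P ∧ x = a / b := by
  constructor
  · intro hx
    obtain ⟨a, b, hab⟩ := IsLocalization.exists_mk'_eq P.primeCompl
      (⟨x, hx⟩ : (LocalSubring.ofPrime A P).toSubring)
    refine ⟨a, b, b.2, ?_⟩
    have hb : (b : K) ≠ 0 := by
      intro h
      apply b.2
      have : (b : A) = 0 := Subtype.ext h
      rw [this]; exact zero_mem _
    rw [eq_div_iff hb]
    have := IsLocalization.mk'_spec (LocalSubring.ofPrime A P).toSubring a b
    rw [hab] at this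
    exact congrArg Subtype.val this
  · rintro ⟨a, b, hb, rfl⟩
    have hb0 : (b : K) ≠ 0 := by
      intro h
      apply hb
      have : (b : A) = 0 := Subtype.ext h
      rw [this]; exact zero_mem _
    have := IsLocalization.mk'_spec (LocalSubring.ofPrime A P).toSubring a
      (⟨b, hb⟩ : P.primeCompl)
    have h2 := congrArg Subtype.val this
    have h3 : ((IsLocalization.mk' (LocalSubring.ofPrime A P).toSubring a
      (⟨b, hb⟩ : P.primeCompl) : (LocalSubring.ofPrime A P).toSubring) : K) = a / b := by
      rw [eq_div_iff hb0]
      exact h2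
    rw [← h3]
    exact Subtype.property _

theorem mem_maximalIdeal_iff_of_le {ν : AddValuation K (WithTop Γ)} {O : LocalSubring K}
    (h : O ≤ (valuationRing ν).toLocalSubring) (a : O.toSubring) :
    a ∈ IsLocalRing.maximalIdeal O.toSubring ↔ 0 < ν a := by
  obtain ⟨h1, h2⟩ := h
  have h3 := mem_maximalIdeal_valuationRing_iff ν ⟨a, h1 a.2⟩
  rw [← h3, IsLocalRing.mem_maximalIdeal, IsLocalRing.mem_maximalIdeal, mem_nonunits_iff,
    mem_nonunits_iff, not_iff_not]
  exact (isUnit_map_iff (Subring.inclusion h1) a).symm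

theorem mem_ofPrime_center_iff {ν : AddValuation K (WithTop Γ)} {S : Subring K}
    (h : S ≤ (valuationRing ν).toSubring) {x : K} :
    x ∈ (LocalSubring.ofPrime S (center ν S h)).toSubring ↔
      ∃ a ∈ S, ∃ b ∈ S, ν b = 0 ∧ x = a / b := by
  rw [mem_ofPrime_iff]
  constructor
  · rintro ⟨a, b, hb, rfl⟩
    refine ⟨a, a.2, b, b.2, ?_, rfl⟩
    rw [mem_center_iff, not_lt] at hb
    exact le_antisymm hb (h b.2)
  · rintro ⟨a, ha, b, hb, hb0, rfl⟩
    refine ⟨⟨a, ha⟩, ⟨b, hb⟩, ?_, rfl⟩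
    rw [mem_center_iff]
    exact hb0.not_gt

theorem ofPrime_center_le {ν : AddValuation K (WithTop Γ)} {S : Subring K}
    (h : S ≤ (valuationRing ν).toSubring) :
    LocalSubring.ofPrime S (center ν S h) ≤ (valuationRing ν).toLocalSubring := by
  have h1 : (LocalSubring.ofPrime S (center ν S h)).toSubring ≤ (valuationRing ν).toSubring := by
    intro x hx
    obtain ⟨a, ha, b, hb, hb0, rfl⟩ := (mem_ofPrime_center_iff h).1 hx
    change 0 ≤ ν (a / b)
    rw [AddValuation.map_div, hb0, sub_zero]
    exact h ha
  refine ⟨h1, ⟨fun x hx => ?_⟩⟩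
  have h2 : ν x = 0 := by
    have h3 : ¬ 0 < ν x := fun hp =>
      (mem_maximalIdeal_valuationRing_iff ν (Subring.inclusion h1 x)).2 hp hx
    exact le_antisymm (not_lt.1 h3) (h1 x.2)
  obtain ⟨a, ha, b, hb, hb0, hab⟩ := (mem_ofPrime_center_iff h).1 x.2
  have hx0 : (x : K) ≠ 0 := by
    intro h0
    rw [h0, AddValuation.map_zero] at h2
    exact WithTop.top_ne_zero h2
  have ha0 : ν a = 0 := by
    rw [hab, AddValuation.map_div, hb0, sub_zero] at h2
    exact h2
  refine IsUnit.of_mul_eq_one ⟨b / a, (mem_ofPrime_center_iff h).2 ⟨b, hb, a, ha, ha0, rfl⟩⟩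
    (Subtype.ext ?_)
  change (x : K) * (b / a) = 1
  rw [← inv_div a b, ← hab, mul_inv_cancel₀ hx0]

/-- Domination determines the prime: its members are the elements of `S` that become nonunits, that
is, those of positive value. -/
theorem eq_ofPrime_center_of_le {ν : AddValuation K (WithTop Γ)} {S : Subring K} {P : Ideal S}
    [P.IsPrime] (hP : LocalSubring.ofPrime S P ≤ (valuationRing ν).toLocalSubring) :
    ∃ h : S ≤ (valuationRing ν).toSubring,
      LocalSubring.ofPrime S P = LocalSubring.ofPrime S (center ν S h) := by
  have h : S ≤ (valuationRing ν).toSubring := (LocalSubring.le_ofPrime S P).trans hP.1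
  refine ⟨h, ?_⟩
  have : P = center ν S h := by
    ext a
    rw [mem_center_iff]
    have h1 := mem_maximalIdeal_iff_of_le hP (algebraMap S _ a)
    have h2 := IsLocalization.AtPrime.to_map_mem_maximal_iff
      (LocalSubring.ofPrime S P).toSubring P a
    rw [← h2, h1]
    rfl
  subst this
  rfl

/-- Fractions of fractions whose denominators have value zero are again such fractions. -/
theorem ofPrime_center_eq_of_le {ν : AddValuation K (WithTop Γ)} {S S' : Subring K}
    (h : S ≤ (valuationRing ν).toSubring) (h' : S' ≤ (valuationRing ν).toSubring) (hS : S ≤ S')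
    (hS' : S' ≤ (LocalSubring.ofPrime S (center ν S h)).toSubring) :
    LocalSubring.ofPrime S (center ν S h) = LocalSubring.ofPrime S' (center ν S' h') := by
  apply LocalSubring.toSubring_injective
  ext x
  constructor
  · intro hx
    obtain ⟨a, ha, b, hb, hb0, rfl⟩ := (mem_ofPrime_center_iff h).1 hx
    exact (mem_ofPrime_center_iff h').2 ⟨a, hS ha, b, hS hb, hb0, rfl⟩
  · intro hx
    obtain ⟨a, ha, b, hb, hb0, rfl⟩ := (mem_ofPrime_center_iff h').1 hx
    obtain ⟨a₁, ha₁, a₂, ha₂, ha0, rfl⟩ := (mem_ofPrime_center_iff h).1 (hS' ha)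
    obtain ⟨b₁, hb₁, b₂, hb₂, hb0', rfl⟩ := (mem_ofPrime_center_iff h).1 (hS' hb)
    rw [AddValuation.map_div, hb0', sub_zero] at hb0
    refine (mem_ofPrime_center_iff h).2 ⟨a₁ * b₂, mul_mem ha₁ hb₂, a₂ * b₁, mul_mem ha₂ hb₁, ?_, ?_⟩
    · rw [AddValuation.map_mul, ha0, hb0, add_zero]
    · rw [div_div_div_eq]

variable {k : Type*} [Field k] [Algebra k K]

theorem IsRationalValuation.exists_sub_pos {ν : AddValuation K (WithTop Γ)}
    (hν : IsRationalValuation k ν) {a : K} (ha : 0 ≤ ν a) :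
    ∃ c : k, 0 < ν (a - algebraMap k K c) := by
  obtain ⟨h, hb⟩ := hν
  obtain ⟨c, hc⟩ := hb.2 (IsLocalRing.residue (valuationRing ν) ⟨a, ha⟩)
  refine ⟨c, ?_⟩
  have h1 : (⟨a, ha⟩ : valuationRing ν) - ⟨algebraMap k K c, h.algebraMap_mem c⟩ ∈
      IsLocalRing.maximalIdeal (valuationRing ν) := by
    rw [← IsLocalRing.residue_eq_zero_iff, map_sub, sub_eq_zero]
    exact hc.symm
  exact (mem_maximalIdeal_valuationRing_iff ν _).1 h1

/-- The `g j` are affine coordinates on the chart of `(1 : g_1 : ⋯ : g_n)` where the first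
coordinate is nonzero. -/
theorem exists_isLocalRingAtCenter_ofPrime_center {ν : AddValuation K (WithTop Γ)} {n : ℕ}
    (g : Fin n → K) (hg : IntermediateField.adjoin k (Set.range g) = ⊤)
    (h : (Algebra.adjoin k (Set.range g)).toSubring ≤ (valuationRing ν).toSubring) :
    ∃ M : ProjectiveModel k K, M.IsLocalRingAtCenter ν
      (LocalSubring.ofPrime (Algebra.adjoin k (Set.range g)).toSubring (center ν _ h)) := by
  let f : Fin (n + 1) → K := Fin.cons 1 g
  have hf0 : f 0 = 1 := rfl
  have hfs : ∀ j, f (Fin.succ j) = g j := fun j => rfl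
  let M : ProjectiveModel k K :=
    { m := n
      f := f
      exists_ne_zero := ⟨0, by rw [hf0]; exact one_ne_zero⟩
      adjoin_eq_top := by
        rw [eq_top_iff, ← hg]
        apply IntermediateField.adjoin.mono
        rintro _ ⟨j, rfl⟩
        exact ⟨0, j.succ, by rw [hf0]; exact one_ne_zero, by rw [hf0, hfs, div_one]⟩ }
  have hchart : M.chart 0 = (Algebra.adjoin k (Set.range g)).toSubring := by
    change (Algebra.adjoin k (Set.range fun j => f j / f 0)).toSubring = _
    congr 1
    apply le_antisymm
    · refine Algebra.adjoin_le ?_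
      rintro _ ⟨j, rfl⟩
      refine Fin.cases ?_ (fun j => ?_) j
      · simp only [hf0, div_one]
        exact one_mem _
      · simp only [hf0, hfs, div_one]
        exact Algebra.subset_adjoin ⟨j, rfl⟩
    · refine Algebra.adjoin_le ?_
      rintro _ ⟨j, rfl⟩
      exact Algebra.subset_adjoin ⟨j.succ, by simp only [hf0, hfs, div_one]⟩
  refine ⟨M, ⟨0, by change f 0 ≠ 0; rw [hf0]; exact one_ne_zero, ?_⟩, ofPrime_center_le h⟩
  rw [hchart]
  exact ⟨center ν _ h, inferInstance, rfl⟩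

/-- The local ring at the center of `ν` in `𝒪[z]`, for the local ring `𝒪` of the center of `ν` in
a projective model and `z` in the valuation ring, is again of this kind. -/
theorem ProjectiveModel.IsLocalRingAtCenter.exists_of_closure {ν : AddValuation K (WithTop Γ)}
    {M : ProjectiveModel k K} {O : LocalSubring K}
    (hM : M.IsLocalRingAtCenter ν O) {T : Set K} {z : K} (hz : z ∈ T)
    (hT : T ⊆ insert z (O.toSubring : Set K))
    (hS : Subring.closure ((O.toSubring : Set K) ∪ T) ≤ (valuationRing ν).toSubring) :
    ∃ M' : ProjectiveModel k K, M'.IsLocalRingAtCenter ν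
      (LocalSubring.ofPrime (Subring.closure ((O.toSubring : Set K) ∪ T)) (center ν _ hS)) := by
  obtain ⟨⟨i, hi, P, hP, rfl⟩, hO⟩ := hM
  obtain ⟨hR, hRO⟩ := eq_ofPrime_center_of_le hO
  -- Add `z` to the affine coordinates of the old chart. Localizing this finitely generated algebra
  -- at its center already yields all of `𝒪`, so it gives the same ring as localizing `𝒪[T]`.
  let g : Fin (M.m + 1 + 1) → K := Fin.cons z fun j => M.f j / M.f i
  have hg0 : g 0 = z := rfl
  have hgs : ∀ j, g (Fin.succ j) = M.f j / M.f i := fun j => rfl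
  have hOS : (LocalSubring.ofPrime (M.chart i) P).toSubring ≤
      Subring.closure (((LocalSubring.ofPrime (M.chart i) P).toSubring : Set K) ∪ T) :=
    fun x hx => Subring.subset_closure (Or.inl hx)
  have hcO : ∀ c : k, algebraMap k K c ∈ (LocalSubring.ofPrime (M.chart i) P).toSubring :=
    fun c => LocalSubring.le_ofPrime _ _
      (Subalgebra.algebraMap_mem (Algebra.adjoin k (Set.range fun j => M.f j / M.f i)) c)
  have hsub : (Algebra.adjoin k (Set.range g)).toSubring ≤
      Subring.closure (((LocalSubring.ofPrime (M.chart i) P).toSubring : Set K) ∪ T) := by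
    intro x hx
    refine Algebra.adjoin_induction (p := fun x _ => x ∈ Subring.closure
      (((LocalSubring.ofPrime (M.chart i) P).toSubring : Set K) ∪ T)) ?_ ?_ ?_ ?_ hx
    · rintro _ ⟨j, rfl⟩
      refine Fin.cases ?_ (fun j => ?_) j
      · rw [hg0]; exact Subring.subset_closure (Or.inr hz)
      · rw [hgs]
        exact hOS (LocalSubring.le_ofPrime _ _ (Algebra.subset_adjoin ⟨j, rfl⟩))
    · exact fun c => hOS (hcO c)
    · exact fun _ _ _ _ ha hb => add_mem ha hb
    · exact fun _ _ _ _ ha hb => mul_mem ha hb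
  have hR' := hsub.trans hS
  have hchart : M.chart i ≤ (Algebra.adjoin k (Set.range g)).toSubring := by
    change Algebra.adjoin k _ ≤ Algebra.adjoin k _
    apply Algebra.adjoin_mono
    rintro _ ⟨j, rfl⟩
    exact ⟨j.succ, hgs j⟩
  rw [← ofPrime_center_eq_of_le hR' hS hsub ?_]
  · apply exists_isLocalRingAtCenter_ofPrime_center
    rw [eq_top_iff, ← M.adjoin_eq_top, IntermediateField.adjoin_le_iff]
    rintro _ ⟨a, b, ha, rfl⟩
    have hmem : ∀ j, M.f j / M.f i ∈ IntermediateField.adjoin k (Set.range g) :=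
      fun j => IntermediateField.subset_adjoin _ _ ⟨j.succ, hgs j⟩
    have : M.f b / M.f a = (M.f b / M.f i) / (M.f a / M.f i) := by
      field_simp
    rw [this]
    exact div_mem (hmem b) (hmem a)
  · rw [Subring.closure_le]
    have h1 : (LocalSubring.ofPrime (M.chart i) P).toSubring ≤
        (LocalSubring.ofPrime _ (center ν _ hR')).toSubring := by
      intro x hx
      rw [hRO] at hx
      obtain ⟨a, ha, b, hb, hb0, rfl⟩ := (mem_ofPrime_center_iff hR).1 hx
      exact (mem_ofPrime_center_iff hR').2 ⟨a, hchart ha, b, hchart hb, hb0, rfl⟩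
    refine Set.union_subset h1 (hT.trans (Set.insert_subset ?_ h1))
    exact LocalSubring.le_ofPrime _ _ (Algebra.subset_adjoin ⟨0, hg0⟩)

end Centers

/-! ### Regular systems of parameters under blow-up -/

section BlowupRing

variable {k K Γ : Type*} [Field k] [Field K] [Algebra k K]
  [AddCommGroup Γ] [LinearOrder Γ] [IsOrderedAddMonoid Γ]

/-- The family `t` is a regular system of parameters of the regular local ring `𝒪 ⊆ K`. -/
structure IsRegularSystem {ι : Type*} [Fintype ι] (O : LocalSubring K) (t : ι → K) : Prop where
  regular : IsRegularLocalRing O.toSubring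
  mem : Set.range t ⊆ O.toSubring
  span_eq : Ideal.span {a : O.toSubring | (a : K) ∈ Set.range t} =
    IsLocalRing.maximalIdeal O.toSubring
  dim_eq : ringKrullDim O.toSubring = Fintype.card ι

variable {ι : Type*} [Fintype ι] {O : LocalSubring K} {t : ι → K}

theorem IsRegularSystem.span_range (h : IsRegularSystem O t) :
    Ideal.span (Set.range fun i => (⟨t i, h.mem ⟨i, rfl⟩⟩ : O.toSubring)) =
      IsLocalRing.maximalIdeal O.toSubring := by
  rw [← h.span_eq]
  congr 1
  ext a
  constructor
  · rintro ⟨i, rfl⟩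
    exact ⟨i, rfl⟩
  · rintro ⟨i, hi⟩
    exact ⟨i, Subtype.ext hi⟩

/-- A zero parameter could be dropped, leaving fewer generators of the maximal ideal than the
dimension. -/
theorem IsRegularSystem.ne_zero (h : IsRegularSystem O t) (i : ι) : t i ≠ 0 := by
  classical
  intro hi
  have := h.regular
  let T : ι → O.toSubring := fun i => ⟨t i, h.mem ⟨i, rfl⟩⟩
  have hspan : Ideal.span (((Finset.univ.erase i).image T : Finset O.toSubring) :
      Set O.toSubring) = IsLocalRing.maximalIdeal O.toSubring := by
    rw [← h.span_range]
    apply le_antisymm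
    · apply Ideal.span_mono
      rw [Finset.coe_image]
      rintro _ ⟨j, -, rfl⟩
      exact ⟨j, rfl⟩
    · rw [Ideal.span_le]
      rintro _ ⟨j, rfl⟩
      by_cases hj : j = i
      · have : (⟨t j, h.mem ⟨j, rfl⟩⟩ : O.toSubring) = 0 := Subtype.ext (by rw [hj]; exact hi)
        change (⟨t j, h.mem ⟨j, rfl⟩⟩ : O.toSubring) ∈ _
        rw [this]
        exact zero_mem _
      · apply Ideal.subset_span
        rw [Finset.coe_image]
        exact ⟨j, by simpa using hj, rfl⟩
  have h1 := IsLocalRing.ringKrullDim_le_card_of_span_eq_maximalIdeal _ hspan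
  rw [h.dim_eq] at h1
  have h2 : Fintype.card ι ≤ ((Finset.univ.erase i).image T).card := by exact_mod_cast h1
  have h3 := h2.trans Finset.card_image_le
  rw [Finset.card_erase_of_mem (Finset.mem_univ i), Finset.card_univ] at h3
  have : 0 < Fintype.card ι := Fintype.card_pos_iff.2 ⟨i⟩
  omega

theorem IsRegularSystem.value_pos (h : IsRegularSystem O t) {ν : AddValuation K (WithTop Γ)}
    (hO : O ≤ (valuationRing ν).toLocalSubring) (i : ι) : 0 < ν (t i) := by
  have : (⟨t i, h.mem ⟨i, rfl⟩⟩ : O.toSubring) ∈ IsLocalRing.maximalIdeal O.toSubring := by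
    rw [← h.span_range]
    exact Ideal.subset_span ⟨i, rfl⟩
  exact (mem_maximalIdeal_iff_of_le hO _).1 this

theorem ProjectiveModel.IsLocalRingAtPoint.algebraMap_mem {M : ProjectiveModel k K}
    (hM : M.IsLocalRingAtPoint O) (c : k) : algebraMap k K c ∈ O.toSubring := by
  obtain ⟨i, hi, P, hP, rfl⟩ := hM
  exact LocalSubring.le_ofPrime _ _
    (Subalgebra.algebraMap_mem (Algebra.adjoin k (Set.range fun j => M.f j / M.f i)) c)

variable [DecidableEq ι]

open Polynomial in
/-- Blowing up the codimension two center `(t i, t j)` along a `k`-rational valuation gives a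
regular local ring, with the regular system of parameters in which `t j` is replaced by
`z = t j / t i - c`. -/
theorem IsRegularSystem.exists_blowup (h : IsRegularSystem O t) {ν : AddValuation K (WithTop Γ)}
    (hν : IsRationalValuation k ν) (hO : ∃ M : ProjectiveModel k K, M.IsLocalRingAtCenter ν O)
    {i j : ι} (hij : i ≠ j) (c : k) {z : K} (hz : t j = t i * (z + algebraMap k K c))
    (hz0 : 0 < ν z) :
    ∃ O' : LocalSubring K, IsLocalizedAdjoin O (Set.range (Function.update t j z)) O' ∧
      (∃ M : ProjectiveModel k K, M.IsLocalRingAtCenter ν O') ∧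
      IsRegularSystem O' (Function.update t j z) := by
  obtain ⟨M, hMP, hM⟩ := hO
  have := h.regular
  have hcO := hMP.algebraMap_mem
  set T : Set K := Set.range (Function.update t j z) with hT
  set S : Subring K := Subring.closure ((O.toSubring : Set K) ∪ T) with hSdef
  have hOS : O.toSubring ≤ S := fun x hx => Subring.subset_closure (Or.inl hx)
  have hTS : T ⊆ S := fun x hx => Subring.subset_closure (Or.inr hx)
  have hzT : z ∈ T := ⟨j, Function.update_self _ _ _⟩
  have htT : ∀ m, m ≠ j → t m ∈ T := fun m hm => ⟨m, Function.update_of_ne hm _ _⟩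
  have hTz : T ⊆ insert z (O.toSubring : Set K) := by
    rintro _ ⟨m, rfl⟩
    by_cases hm : m = j
    · subst hm
      rw [Function.update_self]; exact Or.inl rfl
    · rw [Function.update_of_ne hm]; exact Or.inr (h.mem ⟨m, rfl⟩)
  have hTpos : ∀ x ∈ T, 0 < ν x := by
    rintro _ ⟨m, rfl⟩
    by_cases hm : m = j
    · subst hm
      rw [Function.update_self]; exact hz0
    · rw [Function.update_of_ne hm]; exact h.value_pos hM m
  have hS : S ≤ (valuationRing ν).toSubring := by
    rw [hSdef, Subring.closure_le]
    exact Set.union_subset hM.1 fun x hx => (hTpos x hx).le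
  set P : Ideal S := center ν S hS
  set I : Ideal S := Ideal.span {a : S | (a : K) ∈ T} with hI
  have hIP : I ≤ P := by
    rw [hI, Ideal.span_le]
    exact fun a ha => mem_center_iff.2 (hTpos _ ha)
  have htI : ∀ m, (⟨t m, hOS (h.mem ⟨m, rfl⟩)⟩ : S) ∈ I := by
    intro m
    by_cases hm : m = j
    · have h1 : (⟨t i, hOS (h.mem ⟨i, rfl⟩)⟩ : S) ∈ I := Ideal.subset_span (htT i hij)
      have h2 := I.mul_mem_right (⟨z, hTS hzT⟩ + ⟨algebraMap k K c, hOS (hcO c)⟩) h1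
      convert! h2 using 1
      exact Subtype.ext (by rw [hm]; exact hz)
    · exact Ideal.subset_span (htT m hm)
  have hmI : (IsLocalRing.maximalIdeal O.toSubring).map (Subring.inclusion hOS) ≤ I := by
    rw [← h.span_range, Ideal.map_span, Ideal.span_le]
    rintro _ ⟨_, ⟨m, rfl⟩, rfl⟩
    exact htI m
  -- This is `S = k + I`: by rationality `𝒪` is `k` plus its maximal ideal, which lands in `I`, and
  -- `T` lies in `I`.
  have hdecomp : ∀ a : S, ∃ e : k, a - ⟨algebraMap k K e, hOS (hcO e)⟩ ∈ I := by
    rintro ⟨a, ha⟩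
    refine Subring.closure_induction (p := fun a ha => ∃ e : k,
      (⟨a, ha⟩ : S) - ⟨algebraMap k K e, hOS (hcO e)⟩ ∈ I) ?_ ?_ ?_ ?_ ?_ ?_ ha
    · rintro x (hx | hx)
      · obtain ⟨e, he⟩ := hν.exists_sub_pos (hM.1 hx)
        have h1 : (⟨x, hx⟩ : O.toSubring) - ⟨algebraMap k K e, hcO e⟩ ∈
            IsLocalRing.maximalIdeal O.toSubring := (mem_maximalIdeal_iff_of_le hM _).2 he
        exact ⟨e, hmI (Ideal.mem_map_of_mem (Subring.inclusion hOS) h1)⟩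
      · refine ⟨0, ?_⟩
        have : (⟨x, Subring.subset_closure (Or.inr hx)⟩ : S) -
            ⟨algebraMap k K 0, hOS (hcO 0)⟩ = ⟨x, hTS hx⟩ := Subtype.ext (by simp)
        rw [this]
        exact Ideal.subset_span hx
    · refine ⟨0, ?_⟩
      convert! zero_mem I using 1
      exact Subtype.ext (by simp)
    · refine ⟨1, ?_⟩
      convert! zero_mem I using 1
      exact Subtype.ext (by simp)
    · rintro x y hx hy ⟨e, he⟩ ⟨e', he'⟩
      refine ⟨e + e', ?_⟩
      convert! add_mem he he' using 1
      exact Subtype.ext (by simp; ring)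
    · rintro x hx ⟨e, he⟩
      refine ⟨-e, ?_⟩
      convert! neg_mem he using 1
      exact Subtype.ext (by simp; ring)
    · rintro x y hx hy ⟨e, he⟩ ⟨e', he'⟩
      refine ⟨e * e', ?_⟩
      convert! add_mem (I.mul_mem_right ⟨y, hy⟩ he)
        (I.mul_mem_left ⟨algebraMap k K e, hOS (hcO e)⟩ he') using 1
      exact Subtype.ext (by simp; ring)
  -- The constant part of an element of the center has positive value, hence is zero because `ν` is
  -- trivial on `k`.
  have hPI : P = I := by
    refine le_antisymm (fun a ha => ?_) hIP
    obtain ⟨e, he⟩ := hdecomp a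
    have h1 : (⟨algebraMap k K e, hOS (hcO e)⟩ : S) ∈ P := by
      have := sub_mem ha (hIP he)
      rwa [sub_sub_cancel] at this
    have he0 : e = 0 := by
      by_contra hne
      obtain ⟨hν', -⟩ := hν
      have h2 : 0 < ν (algebraMap k K e) := mem_center_iff.1 h1
      rw [hν'.map_algebraMap e hne] at h2
      exact lt_irrefl _ h2
    subst he0
    convert! he using 1
    exact Subtype.ext (by simp)
  set O' := LocalSubring.ofPrime S P
  refine ⟨O', ⟨P, inferInstance, hPI, rfl⟩,
    ProjectiveModel.IsLocalRingAtCenter.exists_of_closure ⟨hMP, hM⟩ hzT hTz hS, ?_⟩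
  have hSO' : S ≤ O'.toSubring := LocalSubring.le_ofPrime S P
  have hTO' : T ⊆ O'.toSubring := hTS.trans hSO'
  -- the maximal ideal
  have hspan : Ideal.span {a : O'.toSubring | (a : K) ∈ T} =
      IsLocalRing.maximalIdeal O'.toSubring := by
    have hPm : P.map (algebraMap S O'.toSubring) = I.map (algebraMap S O'.toSubring) :=
      congrArg _ hPI
    rw [← IsLocalization.AtPrime.map_eq_maximalIdeal P O'.toSubring, hPm, hI, Ideal.map_span]
    congr 1
    ext a
    constructor
    · intro ha
      exact ⟨⟨a, hTS ha⟩, ha, rfl⟩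
    · rintro ⟨b, hb, rfl⟩
      exact hb
  -- the dimension
  let φ : (O.toSubring)[X] →+* S := eval₂RingHom (Subring.inclusion hOS) ⟨z, hTS hzT⟩
  have hφC : ∀ a, φ (C a) = Subring.inclusion hOS a := fun a => eval₂_C _ _
  have hφX : φ X = ⟨z, hTS hzT⟩ := eval₂_X _ _
  have hφ : Function.Surjective φ := by
    rintro ⟨a, ha⟩
    refine Subring.closure_induction (p := fun a ha => ∃ f, φ f = (⟨a, ha⟩ : S))
      ?_ ?_ ?_ ?_ ?_ ?_ ha
    · intro x hx
      by_cases hxO : x ∈ O.toSubring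
      · exact ⟨C ⟨x, hxO⟩, hφC _⟩
      · have hxz : x = z := (hTz (hx.resolve_left hxO)).resolve_right hxO
        exact ⟨X, by rw [hφX]; exact Subtype.ext hxz.symm⟩
    · exact ⟨0, map_zero φ⟩
    · exact ⟨1, map_one φ⟩
    · rintro x y hx hy ⟨f, hf⟩ ⟨g, hg⟩
      exact ⟨f + g, by rw [map_add, hf, hg]; rfl⟩
    · rintro x hx ⟨f, hf⟩
      exact ⟨-f, by rw [map_neg, hf]; rfl⟩
    · rintro x y hx hy ⟨f, hf⟩ ⟨g, hg⟩
      exact ⟨f * g, by rw [map_mul, hf, hg]; rfl⟩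
  have hinj : Function.Injective (φ.comp C) := by
    intro a b hab
    rw [RingHom.comp_apply, RingHom.comp_apply, hφC, hφC] at hab
    exact Subring.inclusion_injective hOS hab
  have hXP : φ X ∈ P := by rw [hφX]; exact mem_center_iff.2 hz0
  have hCP : ∀ a, φ (C a) ∈ P ↔ a ∈ IsLocalRing.maximalIdeal O.toSubring := by
    intro a
    rw [hφC, mem_maximalIdeal_iff_of_le hM]
    exact mem_center_iff
  have hcomap : P.comap φ = (IsLocalRing.maximalIdeal O.toSubring).map C ⊔ Ideal.span {X} := by
    apply le_antisymm
    · intro f hf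
      have h1 : f.divX * X ∈ Ideal.span {X} :=
        Ideal.mul_mem_left _ _ (Ideal.mem_span_singleton_self _)
      have h2 : φ (C (f.coeff 0)) ∈ P := by
        have h3 : φ f ∈ P := hf
        rw [← f.divX_mul_X_add, map_add, map_mul] at h3
        exact (Ideal.add_mem_iff_right _ (P.mul_mem_left _ hXP)).1 h3
      rw [← f.divX_mul_X_add]
      exact add_mem (Ideal.mem_sup_right h1)
        (Ideal.mem_sup_left (Ideal.mem_map_of_mem _ ((hCP _).1 h2)))
    · rw [sup_le_iff, Ideal.map_le_iff_le_comap, Ideal.span_le, Set.singleton_subset_iff]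
      exact ⟨fun a ha => (hCP a).2 ha, hXP⟩
  obtain ⟨hnoeth, hdim⟩ := ringKrullDim_eq_card_of_blowup (O' := O'.toSubring) φ hφ hinj
    (fun m => (⟨t m, h.mem ⟨m, rfl⟩⟩ : O.toSubring)) h.span_range h.dim_eq hij
    ⟨algebraMap k K c, hcO c⟩
    (by
      rw [map_mul, map_add, hφC, hφC, hφC, hφX]
      exact Subtype.ext hz.symm)
    (fun h0 => h.ne_zero i (congrArg Subtype.val h0)) P hcomap
  have hfin : Set.Finite {a : O'.toSubring | (a : K) ∈ T} := by
    have hTfin : T.Finite := Set.finite_range _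
    exact hTfin.preimage Subtype.val_injective.injOn
  refine ⟨?_, hTO', hspan, hdim⟩
  apply IsRegularLocalRing.of_spanFinrank_maximalIdeal_le
  rw [hdim, ← hspan]
  have h1 := Submodule.spanFinrank_span_le_ncard_of_finite (R := O'.toSubring) hfin
  have h2 : Set.ncard {a : O'.toSubring | (a : K) ∈ T} ≤ Fintype.card ι := by
    have h3 : {a : O'.toSubring | (a : K) ∈ T} ⊆
        Set.range fun m => (⟨Function.update t j z m, hTO' ⟨m, rfl⟩⟩ : O'.toSubring) := by
      rintro a ⟨m, hm⟩
      exact ⟨m, Subtype.ext hm⟩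
    refine (Set.ncard_le_ncard h3 (Set.finite_range _)).trans ?_
    rw [← Set.image_univ]
    refine (Set.ncard_image_le Set.finite_univ).trans ?_
    rw [Set.ncard_univ, Nat.card_eq_fintype_card]
  exact_mod_cast h1.trans h2

end BlowupRing

/-! ### The descent on exponent vectors -/

section Game

variable {ι : Type*} [Fintype ι]

/-- The largest absolute value of an entry of `c`. -/
def maxAbs (c : ι → ℤ) : ℕ := Finset.univ.sup fun a => (c a).natAbs

open Classical in
/-- A measure of integer vectors `c` that decreases when one of two suitable entries of opposite
signs is replaced by their sum. -/
noncomputable def complexity (c : ι → ℤ) : ℕ ×ₗ ℕ ×ₗ ℕ :=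
  toLex (maxAbs c, toLex ((Finset.univ.filter fun a => (c a).natAbs = maxAbs c).card,
    if ∃ a, c a < 0 ∧ (c a).natAbs = maxAbs c then (Finset.univ.filter fun a => 0 < c a).card
    else (Finset.univ.filter fun a => c a < 0).card))

theorem natAbs_le_maxAbs (c : ι → ℤ) (a : ι) : (c a).natAbs ≤ maxAbs c :=
  Finset.le_sup (f := fun a => (c a).natAbs) (Finset.mem_univ a)

variable [DecidableEq ι]

/-- If the old entry had maximal size, the maximum drops or fewer entries attain it. Otherwise the
maximal entries, and with them the branch of the third component, are unchanged, while `a` leaves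
the set which that component counts. -/
theorem complexity_update_lt (c : ι → ℤ) (a : ι) (v : ℤ) (hv : v.natAbs < maxAbs c)
    (h : (c a).natAbs = maxAbs c ∨
      ((∃ b, c b < 0 ∧ (c b).natAbs = maxAbs c) ∧ 0 < c a ∧ v ≤ 0) ∨
      ((¬ ∃ b, c b < 0 ∧ (c b).natAbs = maxAbs c) ∧ c a < 0 ∧ 0 ≤ v)) :
    complexity (Function.update c a v) < complexity c := by
  classical
  set c' := Function.update c a v with hc'
  have hca : c' a = v := Function.update_self _ _ _
  have hcb : ∀ b, b ≠ a → c' b = c b := fun b hb => Function.update_of_ne hb _ _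
  have hM : maxAbs c' ≤ maxAbs c := by
    refine Finset.sup_le fun b _ => ?_
    by_cases hb : b = a
    · subst hb; rw [hca]; exact hv.le
    · rw [hcb b hb]; exact natAbs_le_maxAbs c b
  rw [complexity, complexity, Prod.Lex.toLex_lt_toLex]
  rcases hM.lt_or_eq with hM | hM
  · exact Or.inl hM
  refine Or.inr ⟨hM, ?_⟩
  dsimp only
  rw [Prod.Lex.toLex_lt_toLex, hM]
  have hsub : (Finset.univ.filter fun b => (c' b).natAbs = maxAbs c) ⊆
      (Finset.univ.filter fun b => (c b).natAbs = maxAbs c) := by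
    intro b hb
    rw [Finset.mem_filter] at hb ⊢
    by_cases hba : b = a
    · subst hba; rw [hca] at hb; omega
    · rw [hcb b hba] at hb; exact hb
  by_cases hamax : (c a).natAbs = maxAbs c
  · left
    apply Finset.card_lt_card
    refine ⟨hsub, fun h2 => ?_⟩
    have := h2 (Finset.mem_filter.2 ⟨Finset.mem_univ a, hamax⟩)
    rw [Finset.mem_filter, hca] at this
    omega
  · right
    have hiff : ∀ b, (c' b).natAbs = maxAbs c ↔ (c b).natAbs = maxAbs c := by
      intro b
      by_cases hba : b = a
      · subst hba; rw [hca]; constructor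
        · intro h; omega
        · intro h; exact absurd h hamax
      · rw [hcb b hba]
    have hneg : (∃ b, c' b < 0 ∧ (c' b).natAbs = maxAbs c) ↔
        ∃ b, c b < 0 ∧ (c b).natAbs = maxAbs c := by
      refine exists_congr fun b => ?_
      by_cases hba : b = a
      · subst hba
        have := hiff b
        constructor
        · rintro ⟨-, h⟩; exact absurd (this.1 h) hamax
        · rintro ⟨-, h⟩; exact absurd h hamax
      · rw [hcb b hba]
    refine ⟨by simp only [hiff], ?_⟩
    dsimp only
    rcases h with h | ⟨h1, h2, h3⟩ | ⟨h1, h2, h3⟩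
    · exact absurd h hamax
    · rw [if_pos h1, if_pos (hneg.2 h1)]
      apply Finset.card_lt_card
      refine ⟨fun b hb => ?_, fun h4 => ?_⟩
      · rw [Finset.mem_filter] at hb ⊢
        by_cases hba : b = a
        · subst hba; exact ⟨hb.1, h2⟩
        · rwa [hcb b hba] at hb
      · have := h4 (Finset.mem_filter.2 ⟨Finset.mem_univ a, h2⟩)
        rw [Finset.mem_filter, hca] at this
        omega
    · rw [if_neg h1, if_neg (mt hneg.1 h1)]
      apply Finset.card_lt_card
      refine ⟨fun b hb => ?_, fun h4 => ?_⟩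
      · rw [Finset.mem_filter] at hb ⊢
        by_cases hba : b = a
        · subst hba; exact ⟨hb.1, h2⟩
        · rwa [hcb b hba] at hb
      · have := h4 (Finset.mem_filter.2 ⟨Finset.mem_univ a, h2⟩)
        rw [Finset.mem_filter, hca] at this
        omega

/-- A nontrivial linear relation between positive elements contains two terms of opposite signs,
such that `complexity` decreases when either coefficient is replaced by the sum of the two. -/
theorem exists_complexity_update_lt {r : ℕ} {Γ : Type*} [AddCommGroup Γ] [LinearOrder Γ]
    [IsOrderedAddMonoid Γ] (c : Option (Fin r) → ℤ) (w : Option (Fin r) → Γ) (hw : ∀ o, 0 < w o)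
    (hsum : ∑ o, c o • w o = 0) (h0 : 0 < c none) :
    ∃ (i : Fin r) (b : Option (Fin r)), c (some i) < 0 ∧ 0 < c b ∧
      complexity (Function.update c (some i) (c (some i) + c b)) < complexity c ∧
      complexity (Function.update c b (c (some i) + c b)) < complexity c ∧
      (b = none → w none < w (some i) → 0 < c (some i) + c none) := by
  by_cases hneg : ∃ a, c a < 0 ∧ (c a).natAbs = maxAbs c
  · obtain ⟨a, ha, hamax⟩ := id hneg
    obtain ⟨i, rfl⟩ : ∃ i, a = some i := by
      cases a with
      | none => omega
      | some i => exact ⟨i, rfl⟩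
    -- Here `c (some i) = -M` with `M` the maximum. Changing this entry makes it smaller in size;
    -- changing `c b` instead gives `c b - M ≤ 0`, one positive entry fewer.
    have key : ∀ b, 0 < c b → complexity (Function.update c (some i) (c (some i) + c b)) <
        complexity c ∧ complexity (Function.update c b (c (some i) + c b)) < complexity c := by
      intro b hb
      have hbM := natAbs_le_maxAbs c b
      exact ⟨complexity_update_lt c _ _ (by omega) (Or.inl hamax),
        complexity_update_lt c _ _ (by omega) (Or.inr (Or.inl ⟨hneg, hb, by omega⟩))⟩
    -- An independent partner is preferred: `none` is used only as the sole positive entry, which is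
    -- what proves the last clause.
    by_cases hpos : ∃ m : Fin r, 0 < c (some m)
    · obtain ⟨m, hm⟩ := hpos
      exact ⟨i, some m, ha, hm, (key _ hm).1, (key _ hm).2, fun h => by simp at h⟩
    · push Not at hpos
      refine ⟨i, none, ha, h0, (key _ h0).1, (key _ h0).2, fun _ hlt => ?_⟩
      by_contra hle
      rw [not_lt] at hle
      rw [Fintype.sum_option] at hsum
      -- All other terms of the relation are nonpositive. With `w none < w (some i)` the relation
      -- gives `0 < (c (some i) + c none) • w (some i)`.
      have h1 : ∑ m, c (some m) • w (some m) ≤ c (some i) • w (some i) := by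
        rw [← Finset.add_sum_erase _ _ (Finset.mem_univ i)]
        have : ∑ m ∈ Finset.univ.erase i, c (some m) • w (some m) ≤ 0 :=
          Finset.sum_nonpos fun m _ => smul_nonpos_of_nonpos_of_nonneg (hpos m) (hw _).le
        simpa using this
      have h2 : c none • w none < c none • w (some i) := zsmul_lt_zsmul_right h0 hlt
      have h3 : (c (some i) + c none) • w (some i) ≤ 0 :=
        smul_nonpos_of_nonpos_of_nonneg hle (hw _).le
      rw [add_smul] at h3
      have h4 := add_lt_add_of_lt_of_le h2 h1
      rw [hsum, add_comm] at h4
      exact absurd h4 (not_lt.2 h3)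
  · obtain ⟨i, hi⟩ : ∃ i : Fin r, c (some i) < 0 := by
      by_contra hall
      push Not at hall
      rw [Fintype.sum_option] at hsum
      have h1 : 0 < c none • w none := zsmul_pos (hw _) h0
      have h2 : 0 ≤ ∑ m, c (some m) • w (some m) :=
        Finset.sum_nonneg fun m _ => zsmul_nonneg (hw _).le (hall m)
      exact absurd hsum (add_pos_of_pos_of_nonneg h1 h2).ne'
    -- Now every entry of maximal size is positive and strictly exceeds `|c (some i)|`. The sum is
    -- thus positive and below the maximum: replacing `c b` removes a maximal entry, replacing `c
    -- (some i)` removes a negative one.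
    obtain ⟨b, -, hb⟩ := Finset.exists_mem_eq_sup Finset.univ ⟨none, Finset.mem_univ _⟩
      fun a => (c a).natAbs
    change maxAbs c = (c b).natAbs at hb
    have hnone := natAbs_le_maxAbs c none
    have hbpos : 0 < c b := by
      by_contra h
      exact hneg ⟨b, by omega, hb.symm⟩
    have hiM : (c (some i)).natAbs < maxAbs c :=
      lt_of_le_of_ne (natAbs_le_maxAbs c _) fun h => hneg ⟨some i, hi, h⟩
    refine ⟨i, b, hi, hbpos,
      complexity_update_lt c _ _ (by omega) (Or.inr (Or.inr ⟨hneg, hi, by omega⟩)),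
      complexity_update_lt c _ _ (by omega) (Or.inl hb.symm), fun h _ => ?_⟩
    subst h
    omega

end Game

/-! ### Laurent monomials and their values -/

section Monomials

theorem isUnit_of_dvd_update {ι : Type*} [DecidableEq ι] {c : ι → ℤ} (h : ∀ e : ℤ, (∀ o, e ∣ c o) → IsUnit e) {a b : ι}
    (hab : a ≠ b) (e : ℤ) (he : ∀ o, e ∣ Function.update c a (c a + c b) o) : IsUnit e := by
  refine h e fun o => ?_
  have hb := he b
  rw [Function.update_of_ne hab.symm] at hb
  by_cases ho : o = a
  · subst ho
    have := he o
    rw [Function.update_self] at this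
    exact (dvd_add_left hb).1 this
  · have := he o
    rwa [Function.update_of_ne ho] at this

variable {ι K : Type*} [Fintype ι] [Field K]

/-- The denominator `t a ^ c b` introduced by `(t b / t a) ^ c b` is absorbed by the raised exponent
of `t a`. -/
theorem prod_update_zpow_update [DecidableEq ι] (t : ι → K) (ht : ∀ a, t a ≠ 0) (c : ι → ℤ) {a b : ι}
    (hab : a ≠ b) :
    ∏ o, Function.update t b (t b / t a) o ^ Function.update c a (c a + c b) o =
      ∏ o, t o ^ c o := by
  have ha : a ∈ Finset.univ.erase b := Finset.mem_erase.2 ⟨hab, Finset.mem_univ a⟩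
  rw [← Finset.mul_prod_erase _ _ (Finset.mem_univ b), ← Finset.mul_prod_erase _ _ ha,
    ← Finset.mul_prod_erase Finset.univ (fun o => t o ^ c o) (Finset.mem_univ b),
    ← Finset.mul_prod_erase (Finset.univ.erase b) (fun o => t o ^ c o) ha]
  have : ∏ o ∈ (Finset.univ.erase b).erase a,
      Function.update t b (t b / t a) o ^ Function.update c a (c a + c b) o =
      ∏ o ∈ (Finset.univ.erase b).erase a, t o ^ c o := by
    refine Finset.prod_congr rfl fun o ho => ?_
    simp only [Finset.mem_erase] at ho
    rw [Function.update_of_ne ho.2.1, Function.update_of_ne ho.1]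
  rw [this, Function.update_self, Function.update_self, Function.update_of_ne hab,
    Function.update_of_ne hab.symm, zpow_add₀ (ht a), div_zpow]
  have := zpow_ne_zero (c b) (ht a)
  field_simp

variable {Γ : Type*} [AddCommGroup Γ] [LinearOrder Γ] [IsOrderedAddMonoid Γ]

theorem value_prod_zpow (ν : AddValuation K (WithTop Γ)) (t : ι → K) (w : ι → Γ)
    (h : ∀ o, ν (t o) = (w o : WithTop Γ)) (c : ι → ℤ) :
    ν (∏ o, t o ^ c o) = ((∑ o, c o • w o : Γ) : WithTop Γ) := by
  classical
  have hz : ∀ (x : K) (g : Γ), ν x = g → ∀ n : ℤ, ν (x ^ n) = ((n • g : Γ) : WithTop Γ) := by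
    intro x g hx n
    have hn : ∀ n : ℕ, ν (x ^ n) = ((n • g : Γ) : WithTop Γ) := fun n => by
      rw [AddValuation.map_pow, hx, WithTop.coe_nsmul]
    cases n with
    | ofNat n => simpa using hn n
    | negSucc n =>
      rw [zpow_negSucc, AddValuation.map_inv, hn, negSucc_zsmul,
        WithTop.LinearOrderedAddCommGroup.coe_neg]
  have : ∀ s : Finset ι, ν (∏ o ∈ s, t o ^ c o) = ((∑ o ∈ s, c o • w o : Γ) : WithTop Γ) := by
    intro s
    induction s using Finset.induction_on with
    | empty => simp
    | insert a s ha ih =>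
      rw [Finset.prod_insert ha, Finset.sum_insert ha, AddValuation.map_mul, ih,
        hz _ _ (h a), WithTop.coe_add]
  exact this _

end Monomials

/-! ### Rational bases and primitive integral relations -/

section Bases

theorem exists_basis_update {F V ι : Type*} [Field F] [AddCommGroup V] [Module F V] [Fintype ι]
    [DecidableEq ι] (b : Module.Basis ι F V) (i : ι) (v : V) (h : b.repr v i ≠ 0) :
    ∃ b' : Module.Basis ι F V, ⇑b' = Function.update b i v := by
  have hli : LinearIndependent F (Function.update b i v) := by
    exact b.linearIndependent.update i v ⟨1, one_mem _, b.repr v, mem_nonZeroDivisors_of_ne_zero h,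
      by rw [one_smul, b.linearCombination_repr]⟩
  rcases isEmpty_or_nonempty ι with hι | hι
  · exact hι.elim i
  · exact ⟨basisOfLinearIndependentOfCardEqFinrank hli (Module.finrank_eq_card_basis b).symm,
      coe_basisOfLinearIndependentOfCardEqFinrank _ _⟩

end Bases

/-- The kernel of `Γ → ℚ ⊗ Γ` is torsion, and an ordered group has none. -/
theorem eq_zero_of_one_tmul_eq_zero {Γ : Type*} [AddCommGroup Γ] [LinearOrder Γ]
    [IsOrderedAddMonoid Γ] {g : Γ} (h : (1 : ℚ) ⊗ₜ[ℤ] g = 0) : g = 0 := by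
  have hl : IsLocalizedModule (nonZeroDivisors ℤ) (TensorProduct.mk ℤ ℚ Γ 1) := inferInstance
  obtain ⟨⟨n, hn⟩, hng⟩ := (IsLocalizedModule.eq_zero_iff (nonZeroDivisors ℤ)
    (TensorProduct.mk ℤ ℚ Γ 1)).1 h
  have hng : n • g = 0 := hng
  exact (smul_eq_zero.1 hng).resolve_left (nonZeroDivisors.ne_zero hn)

theorem one_tmul_sum_zsmul {Γ ι : Type*} [AddCommGroup Γ] [Fintype ι] (e : ι → ℤ) (γ : ι → Γ) :
    (1 : ℚ) ⊗ₜ[ℤ] (∑ m, e m • γ m) = ∑ m, (e m : ℚ) • ((1 : ℚ) ⊗ₜ[ℤ] γ m) := by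
  rw [TensorProduct.tmul_sum]
  refine Finset.sum_congr rfl fun m _ => ?_
  rw [TensorProduct.tmul_smul, Int.cast_smul_eq_zsmul]

/-- An element of `Γ` satisfies a primitive integral relation with a family that is a basis of
`Γ ⊗ ℚ`. -/
theorem exists_primitive_relation {Γ : Type*} [AddCommGroup Γ] [LinearOrder Γ]
    [IsOrderedAddMonoid Γ] {r : ℕ} (b : Module.Basis (Fin r) ℚ (ℚ ⊗[ℤ] Γ))
    (w : Option (Fin r) → Γ) (hb : ∀ i, b i = (1 : ℚ) ⊗ₜ[ℤ] w (some i)) :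
    ∃ c : Option (Fin r) → ℤ, 0 < c none ∧ (∀ e : ℤ, (∀ o, e ∣ c o) → IsUnit e) ∧
      ∑ o, c o • w o = 0 := by
  set q := b.repr ((1 : ℚ) ⊗ₜ[ℤ] w none) with hq
  -- Clear the denominators of the coordinates of `w none`; then divide the relation by its gcd,
  -- which torsion-freeness allows, and fix the sign.
  obtain ⟨⟨D, hD⟩, hDq⟩ := IsLocalization.exist_integer_multiples_of_finite (nonZeroDivisors ℤ) q
  choose p hp using hDq
  have hp : ∀ i, (p i : ℚ) = D * q i := fun i => by
    have := hp i
    simpa using this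
  have hD0 : D ≠ 0 := nonZeroDivisors.ne_zero hD
  let c₀ : Option (Fin r) → ℤ := fun o => o.elim D fun i => - p i
  have hc₀ : ∑ o, c₀ o • w o = 0 := by
    apply eq_zero_of_one_tmul_eq_zero
    rw [one_tmul_sum_zsmul, Fintype.sum_option]
    change (D : ℚ) • _ + ∑ i, ((-p i : ℤ) : ℚ) • _ = 0
    have h1 := b.sum_repr ((1 : ℚ) ⊗ₜ[ℤ] w none)
    rw [← h1, Finset.smul_sum, ← Finset.sum_add_distrib]
    refine Finset.sum_eq_zero fun i _ => ?_
    rw [← hb, ← hq, smul_smul, ← add_smul]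
    push_cast
    rw [hp, add_neg_cancel, zero_smul]
  obtain ⟨g, hg, hg1⟩ := Finset.extract_gcd c₀ (Finset.univ_nonempty (α := Option (Fin r)))
  set G := Finset.univ.gcd c₀
  have hg : ∀ o, c₀ o = G * g o := fun o => hg o (Finset.mem_univ o)
  have hDG : D = G * g none := hg none
  have hG0 : G ≠ 0 := by rintro h; rw [h, zero_mul] at hDG; exact hD0 hDG
  have hg0 : g none ≠ 0 := by rintro h; rw [h, mul_zero] at hDG; exact hD0 hDG
  have hgsum : ∑ o, g o • w o = 0 := by
    simp only [hg, mul_smul] at hc₀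
    rw [← Finset.smul_sum] at hc₀
    exact (smul_eq_zero.1 hc₀).resolve_left hG0
  have hgprim : ∀ e : ℤ, (∀ o, e ∣ g o) → IsUnit e := fun e he =>
    isUnit_of_dvd_one (hg1 ▸ Finset.dvd_gcd fun o _ => he o)
  rcases hg0.lt_or_gt with h | h
  · refine ⟨fun o => - g o, neg_pos.2 h, fun e he => hgprim e fun o => (dvd_neg.1 (he o)), ?_⟩
    simp only [neg_smul, Finset.sum_neg_distrib, hgsum, neg_zero]
  · exact ⟨g, h, hgprim, hgsum⟩

/-! ### Blow-ups of parameterized models and the Puiseux package -/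

section Blowups

variable {k K Γ : Type*} [Field k] [Field K] [Algebra k K]
  [AddCommGroup Γ] [LinearOrder Γ] [IsOrderedAddMonoid Γ]
  {ν : AddValuation K (WithTop Γ)} {r s : ℕ}

namespace RegularLocalModel

theorem isRegularSystem (A : RegularLocalModel k ν r s) :
    IsRegularSystem A.O (Sum.elim A.x A.y) where
  regular := A.regular
  mem := by rw [Set.Sum.elim_range]; exact A.params_mem
  span_eq := by rw [Set.Sum.elim_range]; exact A.span_params
  dim_eq := by rw [A.dim_eq, Fintype.card_sum, Fintype.card_fin, Fintype.card_fin]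

/-- The dependent variable `y_l`, followed by the independent variables. -/
def param (A : RegularLocalModel k ν r s) (l : Fin s) (o : Option (Fin r)) : K :=
  o.elim (A.y l) A.x

theorem param_eq (A : RegularLocalModel k ν r s) (l : Fin s) (o : Option (Fin r)) :
    A.param l o = Sum.elim A.x A.y (o.elim (Sum.inr l) Sum.inl) := by
  cases o <;> rfl

theorem param_ne_zero (A : RegularLocalModel k ν r s) (l : Fin s) (o : Option (Fin r)) :
    A.param l o ≠ 0 := by
  rw [param_eq]; exact A.isRegularSystem.ne_zero _

theorem exists_value_param (A : RegularLocalModel k ν r s) (l : Fin s) :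
    ∃ w : Option (Fin r) → Γ, (∀ o, 0 < w o) ∧ (∀ o, ν (A.param l o) = w o) ∧
      ∃ b : Module.Basis (Fin r) ℚ (ℚ ⊗[ℤ] Γ), ∀ i, b i = (1 : ℚ) ⊗ₜ[ℤ] w (some i) := by
  obtain ⟨M, -, hM⟩ := A.isCenter
  have hv : ∀ o, ∃ w : Γ, ν (A.param l o) = w := fun o => by
    have h : ν (A.param l o) ≠ ⊤ := by
      rw [AddValuation.ne_top_iff]
      exact A.param_ne_zero l o
    exact ⟨_, (WithTop.coe_untop _ h).symm⟩
  choose w hw using hv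
  refine ⟨w, fun o => ?_, hw, ?_⟩
  · have := A.isRegularSystem.value_pos hM (o.elim (Sum.inr l) Sum.inl)
    rw [← param_eq, hw] at this
    exact_mod_cast this
  · obtain ⟨b, hb⟩ := A.values_basis
    refine ⟨b, fun i => ?_⟩
    obtain ⟨γ, hγ, hbγ⟩ := hb i
    have h1 : ν (A.x i) = w (some i) := hw (some i)
    rw [hγ] at h1
    rw [hbγ, WithTop.coe_injective h1]

/-- Common construction for all blow-ups: the combinatorial ones have `c = 0`. Only the basis
condition depends on which variable is replaced. -/
theorem exists_isBlowupRing (hν : IsRationalValuation k ν) (A : RegularLocalModel k ν r s)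
    {i j : Fin r ⊕ Fin s} (hij : i ≠ j) (c : k) {z : K}
    (hz : z = Sum.elim A.x A.y j / Sum.elim A.x A.y i - algebraMap k K c) (hz0 : 0 < ν z)
    (x : Fin r → K) (y : Fin s → K)
    (hxy : Sum.elim x y = Function.update (Sum.elim A.x A.y) j z)
    (hb : ∃ b : Module.Basis (Fin r) ℚ (ℚ ⊗[ℤ] Γ),
      ∀ i, ∃ γ : Γ, ν (x i) = (γ : WithTop Γ) ∧ b i = (1 : ℚ) ⊗ₜ[ℤ] γ) :
    ∃ A' : RegularLocalModel k ν r s, IsBlowupRing A A' ∧ A'.x = x ∧ A'.y = y := by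
  have hi := A.isRegularSystem.ne_zero i
  obtain ⟨O', h1, h2, h3⟩ := A.isRegularSystem.exists_blowup hν A.isCenter hij c
    (z := z) (by rw [hz]; field_simp; ring) hz0
  rw [← hxy, Set.Sum.elim_range] at h1
  rw [← hxy] at h3
  refine ⟨⟨O', x, y, h2, h3.regular, ?_, ?_, ?_, hb⟩, h1, rfl, rfl⟩
  · rw [← Set.Sum.elim_range]; exact h3.mem
  · rw [← Set.Sum.elim_range]; exact h3.span_eq
  · rw [h3.dim_eq, Fintype.card_sum, Fintype.card_fin, Fintype.card_fin]

theorem value_div {u v : K} {g h : Γ} (hu : ν u = g) (hv : ν v = h) :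
    ν (v / u) = ((h - g : Γ) : WithTop Γ) := by
  rw [AddValuation.map_div, hu, hv, WithTop.LinearOrderedAddCommGroup.coe_sub]

/-- Combinatorial blow-ups with center `(x_i, x_j)` exist. -/
theorem exists_blowup_indep (hν : IsRationalValuation k ν) (A : RegularLocalModel k ν r s)
    {i j : Fin r} (h : ν (A.x i) < ν (A.x j)) :
    ∃ B : RegularLocalModel k ν r s, IsBlowupRing A B ∧ B.y = A.y ∧
      B.x = Function.update A.x j (A.x j / A.x i) := by
  obtain ⟨b, hb⟩ := A.values_basis
  choose γ hγ hbγ using hb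
  have hij : i ≠ j := by rintro rfl; exact lt_irrefl _ h
  have hlt : γ i < γ j := by rw [hγ, hγ] at h; exact_mod_cast h
  have hval := value_div (hγ i) (hγ j)
  obtain ⟨b', hb'⟩ := exists_basis_update b j (b j - b i) (by
    rw [map_sub, Finsupp.sub_apply, b.repr_self, b.repr_self, Finsupp.single_eq_same,
      Finsupp.single_eq_of_ne hij.symm, sub_zero]
    exact one_ne_zero)
  obtain ⟨B, h1, h2, h3⟩ := A.exists_isBlowupRing hν (i := Sum.inl i) (j := Sum.inl j)
    (by simpa using hij) 0 (z := A.x j / A.x i) (by simp)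
    (by rw [hval]; exact_mod_cast sub_pos.2 hlt) (Function.update A.x j (A.x j / A.x i)) A.y
    (by rw [Sum.update_elim_inl]) ⟨b', fun m => by
      rw [hb']
      by_cases hm : m = j
      · subst hm
        rw [Function.update_self, Function.update_self]
        exact ⟨_, hval, by rw [TensorProduct.tmul_sub, hbγ, hbγ]⟩
      · rw [Function.update_of_ne hm, Function.update_of_ne hm]
        exact ⟨_, hγ m, hbγ m⟩⟩
  exact ⟨B, h1, h3, h2⟩

/-- The blow-up with center `(x_i, y_l)` exists if `y_l` can be replaced by `y_l / x_i - c`. -/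
theorem exists_blowup_dep (hν : IsRationalValuation k ν) (A : RegularLocalModel k ν r s)
    (i : Fin r) (l : Fin s) (c : k) (h : 0 < ν (A.y l / A.x i - algebraMap k K c)) :
    ∃ B : RegularLocalModel k ν r s, IsBlowupRing A B ∧ B.x = A.x ∧
      B.y = Function.update A.y l (A.y l / A.x i - algebraMap k K c) :=
  A.exists_isBlowupRing hν (i := Sum.inl i) (j := Sum.inr l) (by simp) c rfl h _ _
    (by rw [Sum.update_elim_inr]; rfl) A.values_basis

/-- The blow-up with center `(x_i, y_l)` that replaces `x_i` by `x_i / y_l` exists if it keeps the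
values of the independent variables rationally independent. -/
theorem exists_blowup_dep_of_lt (hν : IsRationalValuation k ν) (A : RegularLocalModel k ν r s)
    (i : Fin r) (l : Fin s) (w : Option (Fin r) → Γ) (hw : ∀ o, ν (A.param l o) = w o)
    (hlt : w none < w (some i)) (c : Option (Fin r) → ℤ) (hc : ∑ o, c o • w o = 0)
    (hi : 0 < c (some i) + c none) :
    ∃ B : RegularLocalModel k ν r s, IsBlowupRing A B ∧
      B.x = Function.update A.x i (A.x i / A.y l) ∧ B.y = A.y := by
  obtain ⟨b, hb⟩ := A.values_basis
  have hx : ∀ m, ν (A.x m) = w (some m) := fun m => hw (some m)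
  have hy : ν (A.y l) = w none := hw none
  have hb : ∀ m, b m = (1 : ℚ) ⊗ₜ[ℤ] w (some m) := fun m => by
    obtain ⟨γ, hγ, hbγ⟩ := hb m
    rw [hx] at hγ
    rw [hbγ, WithTop.coe_injective hγ]
  have hval := value_div hy (hx i)
  -- The new basis vector `b i - 1 ⊗ w none` is admissible unless the `i`-th coordinate of `1 ⊗ w
  -- none` is `1`; by this relation that would give `c none + c (some i) = 0`.
  have hrel : (c none : ℚ) * b.repr ((1 : ℚ) ⊗ₜ[ℤ] w none) i + c (some i) = 0 := by
    have h1 := one_tmul_sum_zsmul c w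
    rw [hc, TensorProduct.tmul_zero, Fintype.sum_option] at h1
    simp only [← hb] at h1
    have h2 := congrArg (fun v => b.repr v i) h1
    simp only [map_zero, map_add, map_smul, Finsupp.coe_zero, Pi.zero_apply, Finsupp.add_apply,
      Finsupp.smul_apply, smul_eq_mul, b.repr_sum_self] at h2
    exact h2.symm
  obtain ⟨b', hb'⟩ := exists_basis_update b i (b i - (1 : ℚ) ⊗ₜ[ℤ] w none) (by
    rw [map_sub, Finsupp.sub_apply, b.repr_self, Finsupp.single_eq_same]
    intro h
    rw [← sub_eq_zero.1 h, mul_one] at hrel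
    have : c none + c (some i) = 0 := by exact_mod_cast hrel
    omega)
  exact A.exists_isBlowupRing hν (i := Sum.inr l) (j := Sum.inl i)
    (by simp) 0 (z := A.x i / A.y l) (by simp)
    (by rw [hval]; exact_mod_cast sub_pos.2 hlt) (Function.update A.x i (A.x i / A.y l)) A.y
    (by rw [Sum.update_elim_inl]) ⟨b', fun m => by
      rw [hb']
      by_cases hm : m = i
      · subst hm
        rw [Function.update_self, Function.update_self]
        exact ⟨_, hval, by rw [TensorProduct.tmul_sub, hb]⟩
      · rw [Function.update_of_ne hm, Function.update_of_ne hm]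
        exact ⟨_, hx m, hb m⟩⟩

end RegularLocalModel

theorem IsPuiseuxPackage.of_blowup_indep {l : Fin s} {A B A' : RegularLocalModel k ν r s}
    {i j : Fin r} (h : ν (A.x i) < ν (A.x j)) (hB : IsBlowupRing A B) (hy : B.y = A.y)
    (hx : B.x = Function.update A.x j (A.x j / A.x i)) (hA' : IsPuiseuxPackage l B A') :
    IsPuiseuxPackage l A A' := by
  have hij : i ≠ j := by rintro rfl; exact lt_irrefl _ h
  rcases hij.lt_or_gt with hlt | hlt
  · exact .indep i j hlt ⟨hB, hy, Or.inl ⟨h, hx⟩⟩ hA'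
  · exact .indep j i hlt ⟨hB, hy, Or.inr ⟨h, hx⟩⟩ hA'

theorem contactFunction_eq_prod (A : RegularLocalModel k ν r s) (l : Fin s) (d : ℕ)
    (p : Fin r → ℤ) :
    contactFunction A l d p =
      ∏ o, A.param l o ^ (Option.elim o (d : ℤ) fun i => - p i) := by
  rw [Fintype.prod_option, contactFunction, div_eq_mul_inv, ← Finset.prod_inv_distrib]
  simp [RegularLocalModel.param]

/-- If `ν(y_l)` is an integral combination of the values of the independent variables, then it has
coefficient `±1` in every primitive relation with them. -/
theorem isUnit_of_value_contactFunction_one {A : RegularLocalModel k ν r s} {l : Fin s}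
    {w : Option (Fin r) → Γ} (hw : ∀ o, ν (A.param l o) = w o)
    {b : Module.Basis (Fin r) ℚ (ℚ ⊗[ℤ] Γ)} (hb : ∀ i, b i = (1 : ℚ) ⊗ₜ[ℤ] w (some i))
    {c : Option (Fin r) → ℤ} (hc : ∑ o, c o • w o = 0)
    (hprim : ∀ e : ℤ, (∀ o, e ∣ c o) → IsUnit e) {p : Fin r → ℤ}
    (hp : ν (contactFunction A l 1 p) = 0) :
    IsUnit (c none) ∧ ∀ i, c (some i) = - (c none * p i) := by
  rw [contactFunction_eq_prod, value_prod_zpow ν _ w hw, WithTop.coe_eq_zero,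
    Fintype.sum_option] at hp
  simp only [Option.elim_none, Option.elim_some, Nat.cast_one, one_smul] at hp
  -- Eliminating `w none` leaves a relation between basis vectors, so its coefficients vanish; then
  -- `c none` divides every entry of the primitive vector `c`.
  have h1 : ∑ i, (c (some i) + c none * p i) • w (some i) = 0 := by
    rw [Fintype.sum_option, eq_neg_of_add_eq_zero_left hp, smul_neg, Finset.smul_sum,
      ← Finset.sum_neg_distrib, ← Finset.sum_add_distrib] at hc
    rw [← hc]
    refine Finset.sum_congr rfl fun i _ => ?_
    rw [smul_smul, ← neg_smul, ← add_smul]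
    congr 1
    ring
  have h2 := one_tmul_sum_zsmul (fun i => c (some i) + c none * p i) fun i => w (some i)
  rw [h1, TensorProduct.tmul_zero] at h2
  simp only [← hb] at h2
  have h3 := Fintype.linearIndependent_iff.1 b.linearIndependent _ h2.symm
  have h4 : ∀ i, c (some i) = - (c none * p i) := fun i => by
    have h5 : c (some i) + c none * p i = 0 := by exact_mod_cast h3 i
    omega
  refine ⟨hprim _ fun o => ?_, h4⟩
  cases o with
  | none => exact dvd_rfl
  | some i => rw [h4 i, dvd_neg]; exact dvd_mul_right _ _

/-- Stated for a monomial rather than for `contactFunction` so that model and exponents can vary in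
the induction while the monomial stays the same element of `K`. -/
theorem exists_isPuiseuxPackage (hν : IsRationalValuation k ν) (l : Fin s)
    (A : RegularLocalModel k ν r s) (c : Option (Fin r) → ℤ) (h0 : 0 < c none)
    (hprim : ∀ e : ℤ, (∀ o, e ∣ c o) → IsUnit e) (hc : ν (∏ o, A.param l o ^ c o) = 0) :
    ∃ (A' : RegularLocalModel k ν r s) (ξ : k), IsPuiseuxPackage l A A' ∧ ξ ≠ 0 ∧
      0 < ν (∏ o, A.param l o ^ c o - algebraMap k K ξ) ∧
      A'.y l = ∏ o, A.param l o ^ c o - algebraMap k K ξ := by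
  generalize hμ : complexity c = μ
  induction μ using WellFoundedLT.induction generalizing A c with
  | ind μ ih =>
    subst hμ
    obtain ⟨w, hwpos, hw, b, hb⟩ := A.exists_value_param l
    have hx : ∀ m, ν (A.x m) = w (some m) := fun m => hw (some m)
    have hy : ν (A.y l) = w none := hw none
    have hsum : ∑ o, c o • w o = 0 := by
      rw [value_prod_zpow ν _ w hw] at hc
      exact_mod_cast hc
    obtain ⟨i, a, hi, ha, hμ1, hμ2, hcond⟩ := exists_complexity_update_lt c w hwpos hsum h0
    have hia : some i ≠ a := by rintro rfl; omega
    -- Inductive step for any combinatorial blow-up with `v` replaced by `v / u`: value, primitivity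
    -- and monomial carry over.
    have step : ∀ (B : RegularLocalModel k ν r s) (u v : Option (Fin r)), u ≠ v →
        B.param l = Function.update (A.param l) v (A.param l v / A.param l u) →
        complexity (Function.update c u (c u + c v)) < complexity c →
        0 < Function.update c u (c u + c v) none →
        (∀ A', IsPuiseuxPackage l B A' → IsPuiseuxPackage l A A') →
        ∃ (A' : RegularLocalModel k ν r s) (ξ : k), IsPuiseuxPackage l A A' ∧ ξ ≠ 0 ∧
          0 < ν (∏ o, A.param l o ^ c o - algebraMap k K ξ) ∧
          A'.y l = ∏ o, A.param l o ^ c o - algebraMap k K ξ := by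
      intro B u v huv hB hμ hpos hpack
      have hprod := prod_update_zpow_update (A.param l) (A.param_ne_zero l) c huv
      rw [← hB] at hprod
      obtain ⟨A', ξ, h1, h2⟩ := ih _ hμ B _ hpos (isUnit_of_dvd_update hprim huv)
        (by rw [hprod, hc]) rfl
      rw [hprod] at h2
      exact ⟨A', ξ, hpack A' h1, h2⟩
    rcases lt_trichotomy (w (some i)) (w a) with hlt | heq | hlt
    · cases a with
      | none =>
        obtain ⟨B, hB1, hB2, hB3⟩ := A.exists_blowup_dep hν i l 0 (by
          rw [map_zero, sub_zero, RegularLocalModel.value_div (hx i) hy]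
          exact_mod_cast sub_pos.2 hlt)
        rw [map_zero, sub_zero] at hB3
        have hν1 : ν (A.x i) < ν (A.y l) := by rw [hx, hy]; exact_mod_cast hlt
        refine step B (some i) none hia ?_ hμ1 ?_ fun A' hA' =>
          .dep i ⟨hB1, Or.inl ⟨hν1, hB2, hB3⟩⟩ (fun h => h.2.not_gt hν1) hA'
        · funext o
          cases o with
          | none => simp [RegularLocalModel.param, hB3]
          | some m => simp [RegularLocalModel.param, hB2]
        · rwa [Function.update_of_ne hia.symm]
      | some j =>
        have hν1 : ν (A.x i) < ν (A.x j) := by rw [hx, hx]; exact_mod_cast hlt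
        obtain ⟨B, hB1, hB2, hB3⟩ := A.exists_blowup_indep hν hν1
        refine step B (some i) (some j) hia ?_ hμ1 ?_ fun A' hA' =>
          .of_blowup_indep hν1 hB1 hB2 hB3 hA'
        · funext o
          cases o with
          | none => simp [RegularLocalModel.param, hB2]
          | some m =>
            by_cases hm : m = j
            · subst hm; simp [RegularLocalModel.param, hB3]
            · simp [RegularLocalModel.param, hB3, hm]
        · rwa [Function.update_of_ne (by simp)]
    · cases a with
      | none =>
        have hval : ν (A.y l / A.x i) = 0 := by
          rw [RegularLocalModel.value_div (hx i) hy, heq, sub_self, WithTop.coe_zero]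
        have hcf : contactFunction A l 1 (Pi.single i 1) = A.y l / A.x i := by
          rw [contactFunction, pow_one, Finset.prod_eq_single i]
          · simp
          · intro m _ hm; simp [hm]
          · simp
        -- Since `y_l / x_i` has value zero, uniqueness of the primitive relation makes it the given
        -- monomial.
        obtain ⟨hu, hcp⟩ := isUnit_of_value_contactFunction_one hw hb hsum hprim
          (p := Pi.single i 1) (by rw [hcf, hval])
        have hc1 : c none = 1 := by
          rcases Int.isUnit_iff.1 hu with h | h <;> omega
        have hprod : ∏ o, A.param l o ^ c o = A.y l / A.x i := by
          rw [← hcf, contactFunction_eq_prod]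
          refine Finset.prod_congr rfl fun o _ => ?_
          cases o with
          | none => rw [hc1]; rfl
          | some m => rw [hcp m, hc1, one_mul]; rfl
        rw [hprod]
        obtain ⟨ξ, hξ⟩ := hν.exists_sub_pos hval.ge
        obtain ⟨B, hB1, hB2, hB3⟩ := A.exists_blowup_dep hν i l ξ hξ
        refine ⟨B, ξ, .translation i ⟨hB1, by rw [hx, hy, heq], hB2, ξ, hξ, hB3⟩, ?_, hξ, ?_⟩
        · rintro rfl
          rw [map_zero, sub_zero, hval] at hξ
          exact lt_irrefl _ hξ
        · rw [hB3, Function.update_self]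
      | some j =>
        have hij : b i = b j := by rw [hb, hb, heq]
        exact absurd (congrArg some (b.injective hij)) hia
    · rw [add_comm] at hμ2
      cases a with
      | none =>
        have hpos := hcond rfl hlt
        obtain ⟨B, hB1, hB2, hB3⟩ := A.exists_blowup_dep_of_lt hν i l w hw hlt c hsum hpos
        have hν1 : ν (A.y l) < ν (A.x i) := by rw [hx, hy]; exact_mod_cast hlt
        refine step B none (some i) hia.symm ?_ hμ2 ?_ fun A' hA' =>
          .dep i ⟨hB1, Or.inr ⟨hν1, hB2, hB3⟩⟩ ?_ hA'
        · funext o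
          cases o with
          | none => simp [RegularLocalModel.param, hB3]
          | some m =>
            by_cases hm : m = i
            · subst hm; simp [RegularLocalModel.param, hB2]
            · simp [RegularLocalModel.param, hB2, hm]
        · rw [Function.update_self]; omega
        -- Ramification index `1` would force `c none = 1`, contradicting `c (some i) < 0 < c (some
        -- i) + c none`.
        · rintro ⟨⟨p, -, -, hp⟩, -⟩
          obtain ⟨hu, -⟩ := isUnit_of_value_contactFunction_one hw hb hsum hprim hp
          rcases Int.isUnit_iff.1 hu with h | h <;> omega
      | some j =>
        have hν1 : ν (A.x j) < ν (A.x i) := by rw [hx, hx]; exact_mod_cast hlt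
        obtain ⟨B, hB1, hB2, hB3⟩ := A.exists_blowup_indep hν hν1
        refine step B (some j) (some i) hia.symm ?_ hμ2 ?_ fun A' hA' =>
          .of_blowup_indep hν1 hB1 hB2 hB3 hA'
        · funext o
          cases o with
          | none => simp [RegularLocalModel.param, hB2]
          | some m =>
            by_cases hm : m = i
            · subst hm; simp [RegularLocalModel.param, hB3]
            · simp [RegularLocalModel.param, hB3, hm]
        · rwa [Function.update_of_ne (by simp)]

end Blowups

end PuiseuxPackages

theorem mainTheorem7 {k K Γ : Type*} [Field k] [Field K] [Algebra k K]
    [Algebra.EssFiniteType k K]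
    [AddCommGroup Γ] [LinearOrder Γ] [IsOrderedAddMonoid Γ] [Archimedean Γ]
    (ν : AddValuation K (WithTop Γ)) (hν : IsRationalValuation k ν)
    {r s : ℕ} (A : RegularLocalModel k ν r s) (l : Fin s) :
    ∃ (A' : RegularLocalModel k ν r s) (d : ℕ) (p : Fin r → ℤ) (ξ : k),
      IsPuiseuxPackage l A A' ∧
      IsContactExponent A l d p ∧
      ξ ≠ 0 ∧ 0 < ν (contactFunction A l d p - algebraMap k K ξ) ∧
      A'.y l = contactFunction A l d p - algebraMap k K ξ := by
  obtain ⟨w, -, hw, b, hb⟩ := A.exists_value_param l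
  obtain ⟨c, h0, hprim, hsum⟩ := exists_primitive_relation b w hb
  have hc : ν (∏ o, A.param l o ^ c o) = 0 := by
    rw [value_prod_zpow ν _ w hw, hsum, WithTop.coe_zero]
  have hcf : contactFunction A l (c none).toNat (fun i => - c (some i)) =
      ∏ o, A.param l o ^ c o := by
    rw [contactFunction_eq_prod]
    refine Finset.prod_congr rfl fun o _ => ?_
    cases o with
    | none => rw [Option.elim_none, Int.toNat_of_nonneg h0.le]
    | some i => rw [Option.elim_some, neg_neg]
  obtain ⟨A', ξ, h1, h2, h3, h4⟩ := exists_isPuiseuxPackage hν l A c h0 hprim hc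
  refine ⟨A', (c none).toNat, fun i => - c (some i), ξ, h1, ⟨by omega, ?_, by rw [hcf, hc]⟩, h2,
    by rw [hcf]; exact h3, by rw [hcf]; exact h4⟩
  set e := Nat.gcd (c none).toNat (Finset.univ.gcd fun i => (- c (some i)).natAbs) with he
  -- The gcd condition is primitivity of `c`, since `d` and `p` are its entries up to sign.
  have h5 : IsUnit (e : ℤ) := by
    refine hprim _ fun o => ?_
    cases o with
    | none =>
      rw [← Int.toNat_of_nonneg h0.le]
      exact_mod_cast Nat.gcd_dvd_left _ _
    | some i =>
      rw [← dvd_neg, ← Int.dvd_natAbs]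
      exact_mod_cast (Nat.gcd_dvd_right _ _).trans (Finset.gcd_dvd (Finset.mem_univ i))
  exact Int.ofNat_isUnit.1 h5 |> Nat.isUnit_iff.1
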